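/- Let $d\ge 0$ be an integer, let $T_d$ be the $d$-regular tree with vertex set $V$ and a root $o\in V$, let $\Gamma$ be any group acting on $T_d$ by graph automorphisms (``translations''), and let $A=\{1,-1\}$. For $r\ge 0$ let $T_d(r)$ be the closed ball of radius $r$ about $o$. For $\beta\ge 0$ the (ferromagnetic) Ising interaction $\beta\Phi$ assigns $\beta\,\sigma_u\sigma_v$ to every edge $\{u,v\}$ of $T_d$. An external field is a family $\Psi=(\Psi_v)_{v\in V}$ of functions $\Psi_v:A\to\mathbb{R}$. For a finite set $S\subseteq V$ and a boundary condition $\eta\in A^{V\setminus S}$, the conditional Gibbs measure $\mu_{\beta\Phi+\Psi,S,\eta}$ is the probability measure on $A^S$ with $$\mu_{\beta\Phi+\Psi,S,\eta}(\xi)\propto\exp\Big\{\sum_{\{u,v\}\in E(T_d),\,\{u,v\}\cap S\ne\emptyset}\beta\,\omega_u\omega_v+\sum_{v\in S}\Psi_v(\xi_v)\Big\},\qquad \omega=\xi\vee\eta ,$$ where $\xi\vee\eta$ equals $\xi$ on $S$ and $\eta$ off $S$. A Gibbs state for $\beta\Phi$ is a probability measure $\mu$ on $A^V$ such that, for every finite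 $S\subseteq V$, the marginal of $\mu$ on $A^S$ is $\int\mu_{\beta\Phi,S,\sigma_{V\setminus S}}\,\mu(d\sigma)$. The uniqueness threshold $\beta_c\in[0,\infty]$ is the supremum of all $\beta\ge 0$ for which $\beta\Phi$ has exactly one Gibbs state. Let $\beta\ge 0$ be such that $\beta\Phi$ has exactly one Gibbs state, or such that $\beta<\beta_c$. Then $\beta\Phi$ exhibits strong spatial mixing on $T_d$: it is invariant under the action of $\Gamma$, and for every $a\in A$ $$\lim_{r\to\infty}\ \sup_{\Psi}\ \max_{\eta,\tau\in A^{V\setminus T_d(r)}}\Big|\mu_{\beta\Phi+\Psi,T_d(r),\eta}(\sigma_o=a)-\mu_{\beta\Phi+\Psi,T_d(r),\tau}(\sigma_o=a)\Big|=0,$$ where the supremum is over all external fields $\Psi$. -/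

import Mathlib

/-- An interaction with single-particle states `A` over the vertex set `V`: for every finite set
`F` of vertices a function `A^F → [-∞, ∞)`. The family of sets carrying the interaction is the
family of those `F` whose function is not identically zero; it is required to be locally finite. -/
structure Interaction (V A : Type*) where
  /-- The contribution of the finite set `F`. -/
  energy : (F : Finset V) → (F → A) → WithBot ℝ
  /-- Every vertex lies in only finitely many sets that carry the interaction. -/
  locallyFinite : ∀ v : V, {F : Finset V | v ∈ F ∧ ∃ ξ : F → A, energy F ξ ≠ 0}.Finite

/-- The exponential `[-∞, ∞) → [0, ∞)`, with `exp (-∞) = 0`. -/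
noncomputable def boltzmann (x : WithBot ℝ) : ℝ :=
  WithBot.recBotCoe 0 Real.exp x

open Classical in
/-- `ξ ∨ η`: the configuration equal to `ξ` on `S` and to `η` off `S`. -/
noncomputable def glue {V A : Type*} (S : Finset V) (ξ : S → A) (η : V → A) : V → A :=
  fun v => if h : v ∈ S then ξ ⟨v, h⟩ else η v

namespace Interaction

variable {V A : Type*}

/-- The set `Ω` of configurations with finite local energies. -/
def admissible (Φ : Interaction V A) : Set (V → A) :=
  {σ | ∀ F : Finset V, Φ.energy F (F.restrict σ) ≠ ⊥}

/-- The energy of `ξ ∈ A^S` given the boundary condition `η` off `S`: the sum of the contributions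
of all sets that meet `S` (those contained in `S` and those that meet both `S` and its complement).
Only the values of `η` off `S` are used. -/
noncomputable def condEnergy (Φ : Interaction V A) (S : Finset V) (η : V → A) (ξ : S → A) :
    WithBot ℝ :=
  ∑ᶠ F ∈ {F : Finset V | ∃ v ∈ F, v ∈ S}, Φ.energy F (F.restrict (glue S ξ η))

open Classical in
/-- The conditional Gibbs measure `μ_{S,η}` of the single configuration `ξ ∈ A^S`. -/
noncomputable def condGibbs [Fintype A] (Φ : Interaction V A) (S : Finset V) (η : V → A)
    (ξ : S → A) : ℝ :=
  boltzmann (Φ.condEnergy S η ξ) / ∑ ζ : S → A, boltzmann (Φ.condEnergy S η ζ)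

open Classical in
/-- The probability `μ_{S,η}(σ_v = a)`. -/
noncomputable def condMarginal [Fintype A] (Φ : Interaction V A) (S : Finset V) (η : V → A)
    (v : V) (a : A) : ℝ :=
  ∑ ξ : S → A with glue S ξ η v = a, Φ.condGibbs S η ξ

/-- Gibbs states: probability measures on `A^V` that are supported on the admissible
configurations and satisfy the Dobrushin-Lanford-Ruelle equations. -/
structure IsGibbsState [Fintype A] [MeasurableSpace A] (Φ : Interaction V A)
    (μ : MeasureTheory.Measure (V → A)) : Prop where
  isProbability : MeasureTheory.IsProbabilityMeasure μ
  supported : ∀ᵐ σ ∂μ, σ ∈ Φ.admissible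
  dlr : ∀ (S : Finset V) (ξ : S → A),
    μ {σ | S.restrict σ = ξ} = ∫⁻ σ, ENNReal.ofReal (Φ.condGibbs S σ ξ) ∂μ

/-- There is exactly one Gibbs state. -/
def HasUniqueGibbsState [Fintype A] [MeasurableSpace A] (Φ : Interaction V A) : Prop :=
  ∃! μ : MeasureTheory.Measure (V → A), Φ.IsGibbsState μ

open Classical in
/-- `Φ + Ψ` for a finite-valued self-interaction (external field) `Ψ`: the summand `Ψ v` is added
to the function of the singleton `{v}`, all other functions are unchanged. -/
noncomputable def addField (Φ : Interaction V A) (Ψ : V → A → ℝ) : Interaction V A where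
  energy F ξ := Φ.energy F ξ + ((∑ v : F, if F = {(v : V)} then Ψ v (ξ v) else 0 : ℝ) : WithBot ℝ)
  locallyFinite v := by
    refine ((Φ.locallyFinite v).union (Set.finite_singleton {v})).subset ?_
    rintro F ⟨hv, ξ, hξ⟩
    by_cases hF : F = {v}
    · exact Or.inr hF
    · refine Or.inl ⟨hv, ξ, fun h0 => hξ ?_⟩
      have hs : (∑ w : F, if F = {(w : V)} then Ψ w (ξ w) else 0 : ℝ) = 0 := by
        refine Finset.sum_eq_zero fun w _ => if_neg fun hw => hF ?_
        rw [hw, Finset.mem_singleton] at hv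
        rw [hw, hv]
      rw [h0, hs]
      simp

/-- `Φ` is invariant under the translations of `V` by the elements of the group `Γ`. -/
def IsTranslationInvariant (Γ : Type*) [Group Γ] [MulAction Γ V] (Φ : Interaction V A) : Prop :=
  ∀ (g : Γ) (F : Finset V) (σ : V → A),
    Φ.energy (F.map (MulAction.toPerm g).toEmbedding)
        ((F.map (MulAction.toPerm g).toEmbedding).restrict σ) =
      Φ.energy F (F.restrict fun v => σ (g • v))

end Interaction

open Classical in
/-- The closed ball of radius `r` about the vertex `o` in the graph metric. -/
noncomputable def graphBall {V : Type*} (G : SimpleGraph V) [G.LocallyFinite] (o : V) :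
    ℕ → Finset V
  | 0 => {o}
  | r + 1 => graphBall G o r ∪ (graphBall G o r).biUnion fun v => G.neighborFinset v

/-- The recursive definition gives the vertices that a walk of length at most `r` can reach. -/
theorem mem_graphBall {V : Type*} (G : SimpleGraph V) [G.LocallyFinite] (o v : V) (r : ℕ) :
    v ∈ graphBall G o r ↔ ∃ p : G.Walk o v, p.length ≤ r := by
  induction r generalizing v with
  | zero =>
    simp only [graphBall, Finset.mem_singleton]
    constructor
    · rintro rfl
      exact ⟨SimpleGraph.Walk.nil, le_rfl⟩
    · rintro ⟨p, hp⟩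
      exact (SimpleGraph.Walk.eq_of_length_eq_zero (Nat.le_zero.mp hp)).symm
  | succ r ih =>
    simp only [graphBall, Finset.mem_union, Finset.mem_biUnion, SimpleGraph.mem_neighborFinset]
    constructor
    · rintro (h | ⟨u, hu, huv⟩)
      · obtain ⟨p, hp⟩ := (ih v).mp h
        exact ⟨p, by omega⟩
      · obtain ⟨p, hp⟩ := (ih u).mp hu
        exact ⟨p.concat huv, by rw [SimpleGraph.Walk.length_concat]; omega⟩
    · rintro ⟨p, hp⟩
      induction p using SimpleGraph.Walk.concatRec with
      | Hnil => exact Or.inl ((ih _).mpr ⟨SimpleGraph.Walk.nil, by simp⟩)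
      | Hconcat p h _ =>
        rw [SimpleGraph.Walk.length_concat] at hp
        exact Or.inr ⟨_, (ih _).mpr ⟨p, by omega⟩, h⟩

/-- Strong spatial mixing of an interaction `Φ` on the rooted graph `(G, o)` on which the group
`Γ` acts by translations: `Φ` is translation-invariant, and the influence of the boundary condition
off the ball of radius `r` on the state of the root tends to `0` as `r → ∞`, uniformly over all
finite-valued self-interactions `Ψ`. -/
structure StrongSpatialMixing (Γ : Type*) {V A : Type*} [Group Γ] [MulAction Γ V] [Fintype A]
    (G : SimpleGraph V) [G.LocallyFinite] (o : V) (Φ : Interaction V A) : Prop where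
  translationInvariant : Φ.IsTranslationInvariant Γ
  mixing : ∀ a : A, ∀ ε : ℝ, 0 < ε → ∃ R : ℕ, ∀ r : ℕ, R ≤ r → ∀ Ψ : V → A → ℝ,
    ∀ η ∈ Φ.admissible, ∀ τ ∈ Φ.admissible,
      |(Φ.addField Ψ).condMarginal (graphBall G o r) η o a -
        (Φ.addField Ψ).condMarginal (graphBall G o r) τ o a| < ε

open Classical in
/-- The Ising interaction at inverse temperature `β` on the graph `G`, with state space
`ℤˣ = {1, -1}`: every edge `{u, v}` contributes `β σ_u σ_v`. -/
noncomputable def isingInteraction {V : Type*} (G : SimpleGraph V) [G.LocallyFinite] (β : ℝ) :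
    Interaction V ℤˣ where
  energy F ξ := if ∃ u v, G.Adj u v ∧ F = {u, v} then
    ((β * ∏ x : F, ((ξ x : ℤ) : ℝ) : ℝ) : WithBot ℝ) else 0
  locallyFinite v := by
    refine ((G.neighborFinset v).finite_toSet.image fun w => ({v, w} : Finset V)).subset ?_
    rintro F ⟨hv, ξ, hξ⟩
    have hF : ∃ u w, G.Adj u w ∧ F = {u, w} := by
      by_contra h
      exact hξ (if_neg h)
    obtain ⟨u, w, huw, rfl⟩ := hF
    simp only [Finset.mem_insert, Finset.mem_singleton] at hv
    rcases hv with rfl | rfl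
    · exact ⟨w, by simpa using huw, rfl⟩
    · exact ⟨u, by simpa using huw.symm, Finset.pair_comm _ _⟩

/-- The uniqueness threshold of the ferromagnetic Ising model on `G` without external field: the
supremum of the inverse temperatures `β ≥ 0` with exactly one Gibbs state. -/
noncomputable def isingUniquenessThreshold {V : Type*} (G : SimpleGraph V) [G.LocallyFinite] :
    EReal :=
  sSup ((fun β : ℝ => (β : EReal)) ''
    {β : ℝ | 0 ≤ β ∧ (isingInteraction G β).HasUniqueGibbsState})

/-! Uniqueness and strong mixing are both compared with the condition (d - 1) tanh β ≤ 1. On a tree,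
summing out the spin of a leaf with field x adds the field φ(x) = `edgeMessage β x` to its parent.
Summing out a ball sphere by sphere thus turns the marginal of the root into a logistic function of
one number, `rootField` (`condMarginal_graphBall`); a boundary condition is just a field on the last
sphere.

If (d - 1) tanh β > 1, some x > 0 satisfies x ≤ (d - 1) φ(x), because φ'(0) = tanh β. Under constant
boundary condition s the root field then keeps sign s and size at least x at every radius. Limit
points for s = 1 and s = -1 are different Gibbs states (`mul_tanh_le_one_of_hasUniqueGibbsState`).

If (d - 1) tanh β ≤ 1, an external field cannot increase the influence of the boundary: φ(m + t) -
φ(m - t) ≤ 2 φ(t), so zero external field with opposite boundary fields is the worst case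
(`edgeMessage_add_sub_le`, `abs_rootField_sub_le`). The influence is then bounded by the iterates of
y ↦ (d - 1) φ(y), which tend to 0 because φ(y) < y tanh β for y, β > 0
(`tendsto_iterate_edgeMessage`). This bound is uniform in the external field. -/

/-! ### The message function of one edge. -/

section Messages

open Filter Topology

/-- The log-odds that a spin with field `x` passes on through an edge of strength `β`. -/
noncomputable def edgeMessage (β x : ℝ) : ℝ :=
  (Real.log (Real.cosh (x + β)) - Real.log (Real.cosh (x - β))) / 2

theorem edgeMessage_neg (β x : ℝ) : edgeMessage β (-x) = -edgeMessage β x := by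
  unfold edgeMessage
  rw [← Real.cosh_neg (-x + β), ← Real.cosh_neg (-x - β)]
  ring_nf

theorem edgeMessage_unit_mul (β x : ℝ) (s : ℤˣ) :
    edgeMessage β (((s : ℤ) : ℝ) * x) = ((s : ℤ) : ℝ) * edgeMessage β x := by
  rcases Int.units_eq_one_or s with rfl | rfl <;> simp [edgeMessage_neg]

/-- The sum is 2 cosh(x + β) or 2 cosh(x - β) according to s. A positive function of a sign s has
the form C exp(s b), where log C and b are half the sum and half the difference of its two
logarithms. -/
theorem sum_exp_edge (β x : ℝ) (s : ℤˣ) :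
    ∑ t : ℤˣ, Real.exp (((t : ℤ) : ℝ) * (β * ((s : ℤ) : ℝ) + x)) =
      2 * Real.exp ((Real.log (Real.cosh (x + β)) + Real.log (Real.cosh (x - β))) / 2) *
        Real.exp (((s : ℤ) : ℝ) * edgeMessage β x) := by
  have h2 : ∀ y : ℝ, ∑ t : ℤˣ, Real.exp (((t : ℤ) : ℝ) * y) = 2 * Real.cosh y := by
    intro y
    rw [show (Finset.univ : Finset ℤˣ) = {1, -1} from rfl, Finset.sum_pair (by decide),
      Real.cosh_eq]
    simp
    ring
  rw [h2, mul_assoc, ← Real.exp_add]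
  unfold edgeMessage
  congr 1
  rcases Int.units_eq_one_or s with rfl | rfl
  · rw [← Real.exp_log (Real.cosh_pos (β * (((1 : ℤˣ) : ℤ) : ℝ) + x))]
    congr 1
    simp [add_comm β x]
    ring
  · rw [← Real.exp_log (Real.cosh_pos (β * (((-1 : ℤˣ) : ℤ) : ℝ) + x))]
    congr 1
    simp [neg_add_eq_sub]
    ring

theorem hasDerivAt_edgeMessage (β x : ℝ) :
    HasDerivAt (edgeMessage β)
      (Real.sinh (2 * β) / (Real.cosh (2 * x) + Real.cosh (2 * β))) x := by
  have h1 : HasDerivAt (fun y => Real.cosh (y + β)) (Real.sinh (x + β)) x := by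
    simpa using ((hasDerivAt_id x).add_const β).cosh
  have h2 : HasDerivAt (fun y => Real.cosh (y - β)) (Real.sinh (x - β)) x := by
    simpa using ((hasDerivAt_id x).sub_const β).cosh
  have h := ((h1.log (Real.cosh_pos _).ne').sub (h2.log (Real.cosh_pos _).ne')).div_const 2
  refine h.congr_deriv ?_
  have p1 := Real.cosh_pos (x + β)
  have p2 := Real.cosh_pos (x - β)
  have p3 : ∀ a b : ℝ, 0 < Real.cosh a → 0 < Real.cosh b →
      (Real.sinh a / Real.cosh a - Real.sinh b / Real.cosh b) / 2 =
        Real.sinh (a - b) / (Real.cosh (a + b) + Real.cosh (a - b)) := fun a b ha hb => by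
    rw [Real.cosh_add, Real.cosh_sub, Real.sinh_sub,
      show ∀ u v : ℝ, u + v + (u - v) = 2 * u by intro u v; ring]
    field_simp
  rw [p3 _ _ p1 p2]
  ring_nf

theorem continuous_edgeMessage (β : ℝ) : Continuous (edgeMessage β) :=
  continuous_iff_continuousAt.2 fun x => (hasDerivAt_edgeMessage β x).continuousAt

theorem edgeMessage_zero (β : ℝ) : edgeMessage β 0 = 0 := by
  have := edgeMessage_neg β 0
  rw [neg_zero] at this
  linarith

theorem edgeMessage_mono {β : ℝ} (hβ : 0 ≤ β) : Monotone (edgeMessage β) :=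
  monotone_of_hasDerivAt_nonneg (hasDerivAt_edgeMessage β) fun x => by
    have := Real.cosh_pos (2 * x)
    have := Real.cosh_pos (2 * β)
    have := Real.sinh_nonneg_iff.2 (show 0 ≤ 2 * β by linarith)
    simp only [Pi.zero_apply]
    positivity

theorem edgeMessage_nonneg {β : ℝ} (hβ : 0 ≤ β) {x : ℝ} (hx : 0 ≤ x) : 0 ≤ edgeMessage β x := by
  rw [← edgeMessage_zero β]
  exact edgeMessage_mono hβ hx

theorem edgeMessage_deriv_zero (β : ℝ) :
    Real.sinh (2 * β) / (Real.cosh (2 * 0) + Real.cosh (2 * β)) = Real.tanh β := by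
  rw [Real.tanh_eq_sinh_div_cosh, mul_zero, Real.cosh_zero, Real.sinh_two_mul, Real.cosh_two_mul,
    Real.sinh_sq]
  have h := Real.cosh_pos β
  rw [show 1 + (Real.cosh β ^ 2 + (Real.cosh β ^ 2 - 1)) = 2 * Real.cosh β * Real.cosh β by ring]
  field_simp

/-- The derivative of the message equals tanh β at 0 and is strictly smaller at y > 0, where
cosh(2y) > 1. Strictness is what covers the critical case (d - 1) tanh β = 1. -/
theorem edgeMessage_lt {β : ℝ} (hβ : 0 < β) {x : ℝ} (hx : 0 < x) :
    edgeMessage β x < Real.tanh β * x := by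
  have hd : ∀ y, HasDerivAt (fun y => Real.tanh β * y - edgeMessage β y)
      (Real.tanh β - Real.sinh (2 * β) / (Real.cosh (2 * y) + Real.cosh (2 * β))) y := fun y => by
    have := ((hasDerivAt_id y).const_mul (Real.tanh β)).sub (hasDerivAt_edgeMessage β y)
    rw [mul_one] at this
    exact this
  have hm : StrictMonoOn (fun y => Real.tanh β * y - edgeMessage β y) (Set.Ici 0) := by
    refine strictMonoOn_of_deriv_pos (convex_Ici 0)
      (fun y _ => (hd y).continuousAt.continuousWithinAt) fun y hy => ?_
    rw [interior_Ici, Set.mem_Ioi] at hy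
    rw [(hd y).deriv, sub_pos, ← edgeMessage_deriv_zero, mul_zero, Real.cosh_zero]
    have h1 : 1 < Real.cosh (2 * y) := Real.one_lt_cosh.2 (by positivity)
    have h2 : 0 < Real.sinh (2 * β) := Real.sinh_pos_iff.2 (by positivity)
    have h3 := Real.cosh_pos (2 * β)
    gcongr
  have := hm (Set.mem_Ici.2 le_rfl) (Set.mem_Ici.2 hx.le) hx
  simp only [mul_zero, edgeMessage_zero, sub_zero] at this
  linarith

theorem edgeMessage_le {β : ℝ} (hβ : 0 ≤ β) (x : ℝ) : edgeMessage β x ≤ β := by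
  have h : Real.cosh (x + β) ≤ Real.exp (2 * β) * Real.cosh (x - β) := by
    rw [Real.cosh_eq, Real.cosh_eq]
    have e1 : Real.exp (2 * β) * Real.exp (x - β) = Real.exp (x + β) := by
      rw [← Real.exp_add]; ring_nf
    have e2 : Real.exp (2 * β) * Real.exp (-(x - β)) = Real.exp (-x + 3 * β) := by
      rw [← Real.exp_add]; ring_nf
    have e3 : Real.exp (-(x + β)) ≤ Real.exp (-x + 3 * β) := Real.exp_le_exp.2 (by linarith)
    linarith
  have := Real.log_le_log (Real.cosh_pos _) h
  rw [Real.log_mul (Real.exp_pos _).ne' (Real.cosh_pos _).ne', Real.log_exp] at this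
  unfold edgeMessage
  linarith

/-- After exponentiation and product-to-sum formulas, the inequality becomes (cosh 2m - 1)(cosh²(t +
β) - cosh²(t - β)) ≥ 0. -/
theorem edgeMessage_add_sub_le {β : ℝ} (hβ : 0 ≤ β) (m : ℝ) {t : ℝ} (ht : 0 ≤ t) :
    edgeMessage β (m + t) - edgeMessage β (m - t) ≤ 2 * edgeMessage β t := by
  have c1 := Real.cosh_pos (m + t + β)
  have c2 := Real.cosh_pos (m + t - β)
  have c3 := Real.cosh_pos (m - t + β)
  have c4 := Real.cosh_pos (m - t - β)
  have c5 := Real.cosh_pos (t + β)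
  have c6 := Real.cosh_pos (t - β)
  have hp : ∀ a b : ℝ, Real.cosh a * Real.cosh b =
      (Real.cosh (a + b) + Real.cosh (a - b)) / 2 := fun a b => by
    rw [Real.cosh_add, Real.cosh_sub]; ring
  have h1 : Real.cosh (t - β) ≤ Real.cosh (t + β) :=
    Real.cosh_le_cosh.2 (by rw [abs_of_nonneg (by linarith : 0 ≤ t + β), abs_le]
                            constructor <;> linarith)
  have key : Real.cosh (m + t + β) * Real.cosh (m - t - β) *
      (Real.cosh (t - β) * Real.cosh (t - β)) ≤
      Real.cosh (t + β) * Real.cosh (t + β) *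
        (Real.cosh (m + t - β) * Real.cosh (m - t + β)) := by
    rw [hp (m + t + β), hp (t - β), hp (t + β), hp (m + t - β)]
    ring_nf
    rw [show t * 2 + β * 2 = 2 * (t + β) by ring, show t * 2 - β * 2 = 2 * (t - β) by ring,
      Real.cosh_two_mul, Real.cosh_two_mul, Real.sinh_sq, Real.sinh_sq]
    have hm := Real.one_le_cosh (m * 2)
    have h2 : Real.cosh (t - β) ^ 2 ≤ Real.cosh (t + β) ^ 2 := by gcongr
    simp only [Real.cosh_zero]
    nlinarith [mul_nonneg (sub_nonneg.2 hm) (sub_nonneg.2 h2)]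
  have := Real.log_le_log (by positivity) key
  rw [Real.log_mul (by positivity) (by positivity), Real.log_mul (by positivity) (by positivity),
    Real.log_mul (by positivity) (by positivity), Real.log_mul (by positivity) (by positivity),
    Real.log_mul (by positivity) (by positivity), Real.log_mul (by positivity) (by positivity)]
    at this
  unfold edgeMessage
  linarith

/-- The difference of two messages is largest for opposite fields. -/
theorem abs_edgeMessage_sub_le {β : ℝ} (hβ : 0 ≤ β) {x y δ : ℝ} (h : |x - y| ≤ 2 * δ) :
    |edgeMessage β x - edgeMessage β y| ≤ 2 * edgeMessage β δ := by
  wlog hxy : y ≤ x generalizing x y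
  · rw [abs_sub_comm]
    exact this (by rwa [abs_sub_comm]) (le_of_not_ge hxy)
  rw [abs_of_nonneg (sub_nonneg.2 (edgeMessage_mono hβ hxy))]
  rw [abs_of_nonneg (sub_nonneg.2 hxy)] at h
  have := edgeMessage_add_sub_le hβ ((x + y) / 2) (t := (x - y) / 2) (by linarith)
  rw [show (x + y) / 2 + (x - y) / 2 = x by ring, show (x + y) / 2 - (x - y) / 2 = y by ring]
    at this
  have := edgeMessage_mono hβ (show (x - y) / 2 ≤ δ by linarith)
  linarith

/-- The iterates decrease and stay nonnegative, so they converge to a fixed point; since F y < y for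
y > 0, this can only be 0. -/
theorem tendsto_iterate_edgeMessage {β : ℝ} (hβ : 0 ≤ β) {n : ℕ}
    (hn : (n : ℝ) * Real.tanh β ≤ 1) {x : ℝ} (hx : 0 ≤ x) :
    Tendsto (fun k => (fun y => (n : ℝ) * edgeMessage β y)^[k] x) atTop (𝓝 0) := by
  set F : ℝ → ℝ := fun y => (n : ℝ) * edgeMessage β y with hF
  have hlt : ∀ y, 0 < y → F y < y := fun y hy => by
    rcases hβ.eq_or_lt with rfl | hβ'
    · simpa [hF, edgeMessage] using hy
    · rcases Nat.eq_zero_or_pos n with rfl | hn0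
      · simpa [hF] using hy
      have h1 := mul_lt_mul_of_pos_left (edgeMessage_lt hβ' hy) (Nat.cast_pos.2 hn0 : (0 : ℝ) < n)
      have h2 := mul_le_mul_of_nonneg_right hn hy.le
      simp only [hF]
      linarith
  have hF0 : ∀ y, 0 ≤ y → 0 ≤ F y := fun y hy =>
    mul_nonneg n.cast_nonneg (edgeMessage_nonneg hβ hy)
  have hle : ∀ y, 0 ≤ y → F y ≤ y := fun y hy => by
    rcases hy.eq_or_lt with rfl | hy
    · simp [hF, edgeMessage_zero]
    · exact (hlt y hy).le
  have hnn : ∀ k, 0 ≤ F^[k] x := fun k => by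
    induction k with
    | zero => exact hx
    | succ k ih => rw [Function.iterate_succ_apply']; exact hF0 _ ih
  have hanti : Antitone fun k => F^[k] x := antitone_nat_of_succ_le fun k => by
    rw [Function.iterate_succ_apply']; exact hle _ (hnn k)
  have hlim := tendsto_atTop_ciInf hanti ⟨0, by rintro _ ⟨k, rfl⟩; exact hnn k⟩
  set l := ⨅ k, F^[k] x
  have hl0 : 0 ≤ l := ge_of_tendsto' hlim hnn
  have hfix : F l = l := isFixedPt_of_tendsto_iterate hlim
    ((continuous_const.mul (continuous_edgeMessage β)).continuousAt)
  rcases hl0.eq_or_lt with h | h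
  · rwa [← h] at hlim
  · exact absurd hfix (hlt l h).ne

/-- The right-hand side has slope n tanh β > 1 at 0, so any small enough x > 0 will do. -/
theorem exists_le_edgeMessage {β : ℝ} {n : ℕ} (hn : 1 < (n : ℝ) * Real.tanh β) :
    ∃ x, 0 < x ∧ x ≤ n * edgeMessage β x := by
  have h := (hasDerivAt_edgeMessage β 0).const_mul (n : ℝ)
  rw [edgeMessage_deriv_zero] at h
  have h1 := h.hasDerivWithinAt (s := Set.Ioi 0)
  rw [hasDerivWithinAt_iff_tendsto_slope' (by simp)] at h1
  obtain ⟨x, hx, hx0⟩ := ((h1.eventually (lt_mem_nhds hn)).and self_mem_nhdsWithin).exists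
  replace hx0 : 0 < x := hx0
  refine ⟨x, hx0, ?_⟩
  simp only [slope_def_field, edgeMessage_zero, mul_zero, sub_zero] at hx
  rw [lt_div_iff₀ hx0] at hx
  linarith

end Messages

/-! ### Conditional Gibbs measures: consistency, continuity and limit points. -/

section Specifications

open Filter Topology MeasureTheory

section Glue

variable {V A : Type*}

theorem glue_of_mem {S : Finset V} {ξ : S → A} {η : V → A} {v : V} (h : v ∈ S) :
    glue S ξ η v = ξ ⟨v, h⟩ := dif_pos h

theorem glue_of_notMem {S : Finset V} {ξ : S → A} {η : V → A} {v : V} (h : v ∉ S) :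
    glue S ξ η v = η v := dif_neg h

theorem restrict_glue (S : Finset V) (ξ : S → A) (η : V → A) : S.restrict (glue S ξ η) = ξ :=
  funext fun v => glue_of_mem v.2

theorem glue_congr {S : Finset V} (ξ : S → A) {η τ : V → A} (h : ∀ v, v ∉ S → η v = τ v) :
    glue S ξ η = glue S ξ τ := by
  funext v
  by_cases hv : v ∈ S
  · rw [glue_of_mem hv, glue_of_mem hv]
  · rw [glue_of_notMem hv, glue_of_notMem hv, h v hv]

theorem glue_glue (S : Finset V) (ξ ζ : S → A) (η : V → A) :
    glue S ξ (glue S ζ η) = glue S ξ η :=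
  glue_congr ξ fun _ hv => glue_of_notMem hv

/-- The sum of `f` over all configurations that agree with `η` off `S`. -/
noncomputable def sumOut [Fintype A] (S : Finset V) (f : (V → A) → ℝ) (η : V → A) : ℝ :=
  open Classical in ∑ ξ : S → A, f (glue S ξ η)

theorem sumOut_def [Fintype A] [DecidableEq V] (S : Finset V) (f : (V → A) → ℝ) (η : V → A) :
    sumOut S f η = ∑ ξ : S → A, f (glue S ξ η) := by
  unfold sumOut
  congr!

theorem sumOut_union [Fintype A] {S T Λ : Finset V} (hd : Disjoint S T)
    (hΛ : ∀ v, v ∈ Λ ↔ v ∈ S ∨ v ∈ T) (f : (V → A) → ℝ) (η : V → A) :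
    sumOut Λ f η = sumOut S (sumOut T f) η := by
  classical
  simp only [sumOut_def]
  rw [← Fintype.sum_prod_type' (f := fun (ζ : S → A) (ξ : T → A) => f (glue T ξ (glue S ζ η)))]
  refine Finset.sum_bij' (fun ξ _ => (S.restrict (glue Λ ξ η), T.restrict (glue Λ ξ η)))
    (fun p _ => Λ.restrict (glue T p.2 (glue S p.1 η))) (by simp) (by simp) ?_ ?_ ?_
  · intro ξ _
    funext v
    by_cases hT : (v : V) ∈ T
    · simp [Finset.restrict, glue_of_mem hT, glue_of_mem v.2]
    · have hS : (v : V) ∈ S := ((hΛ v).1 v.2).resolve_right hT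
      simp [Finset.restrict, glue_of_notMem hT, glue_of_mem hS, glue_of_mem v.2]
  · rintro ⟨ζ, ξ⟩ _
    ext v
    · have hS : (v : V) ∈ Λ := (hΛ v).2 (Or.inl v.2)
      have hT : (v : V) ∉ T := Finset.disjoint_left.1 hd v.2
      simp [Finset.restrict, glue_of_notMem hT, glue_of_mem hS, glue_of_mem v.2]
    · have hS : (v : V) ∈ Λ := (hΛ v).2 (Or.inr v.2)
      simp [Finset.restrict, glue_of_mem hS, glue_of_mem v.2]
  · intro ξ _
    congr 1
    funext v
    by_cases hT : v ∈ T
    · simp [glue_of_mem hT, Finset.restrict]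
    · rw [glue_of_notMem hT]
      by_cases hS : v ∈ S
      · simp [glue_of_mem hS, Finset.restrict]
      · rw [glue_of_notMem hS, glue_of_notMem fun h => ((hΛ v).1 h).elim hS hT]

theorem sumOut_mul_left [Fintype A] {S : Finset V} {c : (V → A) → ℝ}
    (hc : ∀ (ξ : S → A) η, c (glue S ξ η) = c η) (f : (V → A) → ℝ) (η : V → A) :
    sumOut S (fun ω => c ω * f ω) η = c η * sumOut S f η := by
  classical
  simp only [sumOut_def, hc, Finset.mul_sum]

end Glue

namespace Interaction

variable {V A : Type*}

/-- The real-valued energy of all sets that meet `S`, for an interaction without `-∞`. -/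
noncomputable def realEnergy (Φ : Interaction V A) (S : Finset V) (ω : V → A) : ℝ :=
  ∑ᶠ F ∈ {F : Finset V | ∃ v ∈ F, v ∈ S}, (Φ.energy F (F.restrict ω)).unbotD 0

theorem finite_carrying (Φ : Interaction V A) (S : Finset V) :
    {F : Finset V | (∃ v ∈ F, v ∈ S) ∧ ∃ ξ : F → A, Φ.energy F ξ ≠ 0}.Finite := by
  refine (S.finite_toSet.biUnion fun v _ => Φ.locallyFinite v).subset ?_
  rintro F ⟨⟨v, hF, hS⟩, h⟩
  exact Set.mem_biUnion hS ⟨hF, h⟩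

theorem finite_inter_support (Φ : Interaction V A) (S : Finset V) (ω : V → A)
    {s : Set (Finset V)} (hs : s ⊆ {F : Finset V | ∃ v ∈ F, v ∈ S}) :
    (s ∩ Function.support fun F => (Φ.energy F (F.restrict ω)).unbotD 0).Finite := by
  refine (Φ.finite_carrying S).subset ?_
  rintro F ⟨h, h'⟩
  refine ⟨hs h, F.restrict ω, fun h0 => h' ?_⟩
  simp [h0]

theorem condEnergy_eq {Φ : Interaction V A} (hΦ : ∀ F ξ, Φ.energy F ξ ≠ ⊥) (S : Finset V)
    (η : V → A) (ξ : S → A) :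
    Φ.condEnergy S η ξ = ((Φ.realEnergy S (glue S ξ η) : ℝ) : WithBot ℝ) := by
  unfold condEnergy realEnergy
  -- The coercion commutes with `finsum` only on finite support, which local finiteness supplies.
  have := (WithBot.addHom : ℝ →+ WithBot ℝ).map_finsum_mem'
    (Φ.finite_inter_support S (glue S ξ η) subset_rfl)
  rw [WithBot.coe_addHom] at this
  erw [this]
  refine finsum_mem_congr rfl fun F _ => ?_
  obtain ⟨x, hx⟩ := WithBot.ne_bot_iff_exists.1 (hΦ F (F.restrict (glue S ξ η)))
  rw [← hx]
  rfl

theorem continuous_realEnergy (Φ : Interaction V A) [Finite A] [TopologicalSpace A]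
    [DiscreteTopology A] (S : Finset V) : Continuous (Φ.realEnergy S) := by
  have h : ∀ ω, Φ.realEnergy S ω = ∑ F ∈ (Φ.finite_carrying S).toFinset,
      (Φ.energy F (F.restrict ω)).unbotD 0 := fun ω => by
    refine finsum_mem_eq_sum_of_subset _ ?_ ?_
    · rintro F ⟨h, h'⟩
      simp only [Set.Finite.coe_toFinset]
      refine ⟨h, F.restrict ω, fun h0 => h' ?_⟩
      simp [h0]
    · intro F hF
      simp only [Set.Finite.coe_toFinset] at hF
      exact hF.1
  rw [funext h]
  refine continuous_finsetSum _ fun F _ => ?_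
  exact (continuous_of_discreteTopology (f := fun ξ : F → A => (Φ.energy F ξ).unbotD 0)).comp
    (by fun_prop)

/-- `R` collects the sets that meet `Λ` but miss `S`, so it does not see the spins in `S`. -/
theorem exists_realEnergy_eq_add (Φ : Interaction V A) {S Λ : Finset V} (hS : S ⊆ Λ) :
    ∃ R : (V → A) → ℝ, (∀ (ξ : S → A) η, R (glue S ξ η) = R η) ∧
      ∀ ω, Φ.realEnergy Λ ω = R ω + Φ.realEnergy S ω := by
  refine ⟨fun ω => ∑ᶠ F ∈ {F : Finset V | (∃ v ∈ F, v ∈ Λ) ∧ ¬ ∃ v ∈ F, v ∈ S},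
    (Φ.energy F (F.restrict ω)).unbotD 0, fun ξ η => finsum_mem_congr rfl fun F hF => ?_,
    fun ω => ?_⟩
  · have : F.restrict (glue S ξ η) = F.restrict η := funext fun v =>
      glue_of_notMem fun h => hF.2 ⟨v, v.2, h⟩
    rw [this]
  · unfold realEnergy
    rw [← finsum_mem_union']
    · refine finsum_mem_congr ?_ fun _ _ => rfl
      ext F
      simp only [Set.mem_union, Set.mem_ofPred_eq]
      constructor
      · intro h
        by_cases h' : ∃ v ∈ F, v ∈ S
        · exact Or.inr h'
        · exact Or.inl ⟨h, h'⟩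
      · rintro (h | ⟨v, hv, h⟩)
        · exact h.1
        · exact ⟨v, hv, hS h⟩
    · exact Set.disjoint_left.2 fun F h h' => h.2 h'
    · exact Φ.finite_inter_support Λ ω fun F h => h.1
    · exact Φ.finite_inter_support S ω subset_rfl

variable [Fintype A]

theorem sumOut_exp_pos (Φ : Interaction V A) (S : Finset V) (η : V → A) :
    0 < sumOut S (fun ω => Real.exp (Φ.realEnergy S ω)) η := by
  classical
  exact Finset.sum_pos (fun _ _ => Real.exp_pos _) ⟨S.restrict η, Finset.mem_univ _⟩

theorem condGibbs_eq {Φ : Interaction V A} (hΦ : ∀ F ξ, Φ.energy F ξ ≠ ⊥) (S : Finset V)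
    (η : V → A) (ξ : S → A) :
    Φ.condGibbs S η ξ = Real.exp (Φ.realEnergy S (glue S ξ η)) /
      sumOut S (fun ω => Real.exp (Φ.realEnergy S ω)) η := by
  unfold condGibbs sumOut
  simp only [condEnergy_eq hΦ]
  rfl

theorem condGibbs_nonneg {Φ : Interaction V A} (hΦ : ∀ F ξ, Φ.energy F ξ ≠ ⊥) (S : Finset V)
    (η : V → A) (ξ : S → A) : 0 ≤ Φ.condGibbs S η ξ := by
  rw [condGibbs_eq hΦ]
  exact div_nonneg (Real.exp_pos _).le (Φ.sumOut_exp_pos S η).le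

theorem condGibbs_glue (Φ : Interaction V A) (S : Finset V) (ζ : S → A) (η : V → A) (ξ : S → A) :
    Φ.condGibbs S (glue S ζ η) ξ = Φ.condGibbs S η ξ := by
  simp only [condGibbs, condEnergy, glue_glue]

open Classical in
theorem sum_condGibbs_mul {Φ : Interaction V A} (hΦ : ∀ F ξ, Φ.energy F ξ ≠ ⊥) (S : Finset V)
    (f : (V → A) → ℝ) (η : V → A) :
    ∑ ξ : S → A, Φ.condGibbs S η ξ * f (glue S ξ η) =
      sumOut S (fun ω => Real.exp (Φ.realEnergy S ω) * f ω) η /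
        sumOut S (fun ω => Real.exp (Φ.realEnergy S ω)) η := by
  simp only [condGibbs_eq hΦ]
  rw [sumOut_def S (fun ω => Real.exp (Φ.realEnergy S ω) * f ω), Finset.sum_div]
  exact Finset.sum_congr rfl fun ξ _ => by ring

open Classical in
theorem condMarginal_eq {Φ : Interaction V A} (hΦ : ∀ F ξ, Φ.energy F ξ ≠ ⊥) (S : Finset V)
    (η : V → A) (v : V) (a : A) :
    Φ.condMarginal S η v a =
      sumOut S (fun ω => Real.exp (Φ.realEnergy S ω) * if ω v = a then 1 else 0) η /
        sumOut S (fun ω => Real.exp (Φ.realEnergy S ω)) η := by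
  rw [← sum_condGibbs_mul hΦ, condMarginal, Finset.sum_filter]
  exact Finset.sum_congr rfl fun ξ _ => by split_ifs <;> simp

open Classical in
/-- Consistency of the conditional Gibbs measures. -/
theorem sum_condGibbs_condGibbs {Φ : Interaction V A} (hΦ : ∀ F ξ, Φ.energy F ξ ≠ ⊥)
    {S Λ : Finset V} (hS : S ⊆ Λ) (η : V → A) (ζ : S → A) :
    ∑ ξ : Λ → A, Φ.condGibbs Λ η ξ * Φ.condGibbs S (glue Λ ξ η) ζ =
      ∑ ξ : Λ → A, Φ.condGibbs Λ η ξ * if S.restrict (glue Λ ξ η) = ζ then 1 else 0 := by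
  rw [sum_condGibbs_mul hΦ Λ (fun ω => Φ.condGibbs S ω ζ),
    sum_condGibbs_mul hΦ Λ (fun ω => if S.restrict ω = ζ then 1 else 0)]
  congr 1
  have hu : ∀ v, v ∈ Λ ↔ v ∈ Λ \ S ∨ v ∈ S := fun v => by
    rw [Finset.mem_sdiff]
    constructor
    · intro h
      by_cases h' : v ∈ S <;> simp [h, h']
    · rintro (h | h)
      exacts [h.1, hS h]
  -- Sum over the spins in `S` first. The factor exp(R) is constant there, which leaves an identity
  -- for the volume `S` alone.
  obtain ⟨R, hR, hE⟩ := Φ.exists_realEnergy_eq_add hS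
  rw [sumOut_union Finset.sdiff_disjoint hu, sumOut_union Finset.sdiff_disjoint hu]
  congr 1
  funext ω
  simp only [hE, Real.exp_add, mul_assoc]
  rw [sumOut_mul_left (c := fun ω => Real.exp (R ω)) (fun ξ η => by rw [hR]),
    sumOut_mul_left (c := fun ω => Real.exp (R ω)) (fun ξ η => by rw [hR])]
  congr 1
  -- The conditional probability depends only on the spins off `S`, so it leaves the inner sum and
  -- cancels the partition function.
  have h1 := sumOut_mul_left (c := fun ω => Φ.condGibbs S ω ζ)
    (fun ξ η => Φ.condGibbs_glue S ξ η ζ) (fun ω => Real.exp (Φ.realEnergy S ω)) ω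
  simp only [mul_comm (Φ.condGibbs S _ ζ)] at h1
  rw [h1, condGibbs_eq hΦ, mul_div_cancel₀ _ (Φ.sumOut_exp_pos S ω).ne', sumOut_def]
  simp [restrict_glue]

/-- By local finiteness only finitely many spins of η matter. Continuity lets the DLR equations pass
to weak limits. -/
theorem continuous_condGibbs {Φ : Interaction V A} (hΦ : ∀ F ξ, Φ.energy F ξ ≠ ⊥)
    [TopologicalSpace A] [DiscreteTopology A] (S : Finset V) (ξ : S → A) :
    Continuous fun η => Φ.condGibbs S η ξ := by
  have hg : ∀ ζ : S → A, Continuous fun η : V → A => glue S ζ η := fun ζ => by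
    refine continuous_pi fun v => ?_
    by_cases hv : v ∈ S
    · simp only [glue_of_mem hv]
      exact continuous_const
    · simp only [glue_of_notMem hv]
      exact continuous_apply v
  simp only [condGibbs_eq hΦ]
  refine Continuous.div ?_ ?_ fun η => (Φ.sumOut_exp_pos S η).ne'
  · exact Real.continuous_exp.comp ((Φ.continuous_realEnergy S).comp (hg ξ))
  · exact continuous_finsetSum _ fun ζ _ =>
      Real.continuous_exp.comp ((Φ.continuous_realEnergy S).comp (hg ζ))

open Classical in
/-- The conditional Gibbs measure as a measure on all configurations, equal to `η` off `S`. -/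
noncomputable def finiteGibbs [MeasurableSpace A] (Φ : Interaction V A) (S : Finset V)
    (η : V → A) : Measure (V → A) :=
  ∑ ξ : S → A, ENNReal.ofReal (Φ.condGibbs S η ξ) • Measure.dirac (glue S ξ η)

variable [MeasurableSpace A]

theorem isProbabilityMeasure_finiteGibbs {Φ : Interaction V A} (hΦ : ∀ F ξ, Φ.energy F ξ ≠ ⊥)
    (S : Finset V) (η : V → A) : IsProbabilityMeasure (Φ.finiteGibbs S η) := by
  classical
  constructor
  simp only [finiteGibbs, Measure.coe_finsetSum, Finset.sum_apply, Measure.smul_apply,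
    measure_univ, smul_eq_mul, mul_one]
  rw [← ENNReal.ofReal_sum_of_nonneg fun _ _ => condGibbs_nonneg hΦ _ _ _]
  have := sum_condGibbs_mul hΦ S (fun _ => 1) η
  simp only [mul_one] at this
  rw [this, div_self (Φ.sumOut_exp_pos S η).ne', ENNReal.ofReal_one]

open Classical in
theorem integral_finiteGibbs {Φ : Interaction V A} (hΦ : ∀ F ξ, Φ.energy F ξ ≠ ⊥)
    (S : Finset V) (η : V → A) {f : (V → A) → ℝ} (hf : StronglyMeasurable f) :
    ∫ ω, f ω ∂Φ.finiteGibbs S η = ∑ ξ : S → A, Φ.condGibbs S η ξ * f (glue S ξ η) := by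
  unfold finiteGibbs
  rw [integral_finsetSum_measure]
  · refine Finset.sum_congr rfl fun ξ _ => ?_
    rw [integral_smul_measure, integral_dirac' _ _ hf,
      ENNReal.toReal_ofReal (condGibbs_nonneg hΦ _ _ _), smul_eq_mul]
  · intro ξ _
    exact (integrable_dirac' hf (by simp)).smul_measure ENNReal.ofReal_ne_top

/-- Along an exhausting sequence of volumes the conditional Gibbs measures with a fixed boundary
condition have a limit point, and it is a Gibbs state. -/
theorem exists_isGibbsState [Countable V] [TopologicalSpace A] [DiscreteTopology A] [BorelSpace A]
    {Φ : Interaction V A} (hΦ : ∀ F ξ, Φ.energy F ξ ≠ ⊥) {Λ : ℕ → Finset V} (hΛ : Monotone Λ)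
    (hex : ∀ S, ∃ n, S ⊆ Λ n) (η : V → A) :
    ∃ μ, Φ.IsGibbsState μ ∧ ∀ (v : V) (a : A) (c : ℝ),
      (∀ᶠ n in atTop, c ≤ Φ.condMarginal (Λ n) η v a) → c ≤ μ.real {σ | σ v = a} := by
  classical
  let P : ℕ → ProbabilityMeasure (V → A) := fun n =>
    ⟨Φ.finiteGibbs (Λ n) η, isProbabilityMeasure_finiteGibbs hΦ _ _⟩
  -- The probability measures on A^V form a compact space; a free ultrafilter replaces the choice of
  -- a convergent subsequence.
  obtain ⟨μ, -, hμ⟩ := isCompact_univ.ultrafilter_le_nhds ((hyperfilter ℕ).map P) (by simp)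
  have ht : Tendsto P (hyperfilter ℕ) (𝓝 μ) := hμ
  rw [ProbabilityMeasure.tendsto_iff_forall_integral_tendsto] at ht
  have hle : (hyperfilter ℕ : Filter ℕ) ≤ atTop := Nat.hyperfilter_le_atTop
  have ht' : ∀ f : (V → A) → ℝ, Continuous f →
      Tendsto (fun n => ∑ ξ : Λ n → A, Φ.condGibbs (Λ n) η ξ * f (glue (Λ n) ξ η))
        (hyperfilter ℕ) (𝓝 (∫ ω, f ω ∂(μ : Measure (V → A)))) := fun f hf => by
    have h := ht (BoundedContinuousFunction.mkOfCompact ⟨f, hf⟩)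
    simp only [BoundedContinuousFunction.mkOfCompact_apply, ContinuousMap.coe_mk] at h
    refine h.congr fun n => ?_
    exact integral_finiteGibbs hΦ _ _ hf.stronglyMeasurable
  -- Cylinder sets are clopen, so their indicators are continuous test functions.
  have hcyl : ∀ (S : Finset V) (s : Set (S → A)),
      Continuous (Set.indicator (S.restrict ⁻¹' s) (1 : (V → A) → ℝ)) ∧
        MeasurableSet (S.restrict ⁻¹' s : Set (V → A)) := fun S s => by
    have : IsClopen (S.restrict ⁻¹' s : Set (V → A)) :=
      (isClopen_discrete s).preimage (by fun_prop)
    exact ⟨continuous_one.indicator (by simp [this.frontier_eq]), this.2.measurableSet⟩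
  refine ⟨μ, ⟨inferInstance, ae_of_all _ fun σ F => hΦ _ _, fun S ζ => ?_⟩, fun v a c hc => ?_⟩
  · have h1 := ht' _ (hcyl S {ζ}).1
    have h2 := ht' _ (continuous_condGibbs hΦ S ζ)
    obtain ⟨N, hN⟩ := hex S
    have he : ∀ᶠ n in (hyperfilter ℕ : Filter ℕ), S ⊆ Λ n :=
      hle (eventually_atTop.2 ⟨N, fun n hn => hN.trans (hΛ hn)⟩)
    -- By consistency the two sequences agree as soon as `S ⊆ Λ n`.
    have h3 := tendsto_nhds_unique_of_eventuallyEq h1 h2 (he.mono fun n hn => by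
      refine Eq.trans ?_ (sum_condGibbs_condGibbs hΦ hn η ζ).symm
      refine Finset.sum_congr rfl fun ξ _ => ?_
      simp [Set.indicator_apply])
    rw [integral_indicator_one (hcyl S {ζ}).2] at h3
    rw [← ofReal_integral_eq_lintegral_ofReal, ← h3, ofReal_measureReal]
    · rfl
    · exact (BoundedContinuousFunction.mkOfCompact
        ⟨_, continuous_condGibbs hΦ S ζ⟩).integrable (μ : Measure (V → A))
    · exact ae_of_all _ fun σ => condGibbs_nonneg hΦ _ _ _
  · have h1 := ht' _ (hcyl {v} {ξ | ξ ⟨v, Finset.mem_singleton_self v⟩ = a}).1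
    rw [integral_indicator_one (hcyl _ _).2] at h1
    refine ge_of_tendsto h1 ((hc.filter_mono hle).mono fun n hn => ?_)
    refine hn.trans_eq ?_
    rw [condMarginal, Finset.sum_filter]
    refine Finset.sum_congr rfl fun ξ _ => ?_
    simp [Set.indicator_apply]

end Interaction

end Specifications

/-! ### Parents, children and balls in a rooted tree. -/

section Trees

namespace SimpleGraph

variable {V : Type*} {T : SimpleGraph V}

/-- Geodesics from o to v through u and through u' are both paths, hence equal, and so are their
penultimate vertices. -/
theorem Adj.eq_of_dist_eq_add_one (hT : T.IsTree) {o u u' v : V} (h : T.Adj u v) (h' : T.Adj u' v)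
    (hu : T.dist o v = T.dist o u + 1) (hu' : T.dist o v = T.dist o u' + 1) : u = u' := by
  obtain ⟨p, hp⟩ := (hT.connected o u).exists_walk_length_eq_dist
  obtain ⟨p', hp'⟩ := (hT.connected o u').exists_walk_length_eq_dist
  have h1 : (p.concat h).IsPath := Walk.isPath_of_length_eq_dist _ (by
    rw [Walk.length_concat, hp, hu])
  have h2 : (p'.concat h').IsPath := Walk.isPath_of_length_eq_dist _ (by
    rw [Walk.length_concat, hp', hu'])
  have := congrArg Walk.penultimate ((hT.existsUnique_path o v).unique h1 h2)
  simpa using this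

theorem IsTree.exists_parent (hT : T.IsTree) (o : V) : ∃ par : V → V,
    (∀ v, v ≠ o → T.Adj (par v) v ∧ T.dist o v = T.dist o (par v) + 1) ∧
      ∀ u v, T.Adj u v → T.dist o v = T.dist o u + 1 → par v = u := by
  have h : ∀ v, v ≠ o → ∃ u, T.Adj u v ∧ T.dist o v = T.dist o u + 1 := fun v hv => by
    obtain ⟨p, hp⟩ := (hT.connected v o).exists_walk_length_eq_dist
    cases p with
    | nil => exact absurd rfl hv
    | cons hadj q =>
      rename_i u
      refine ⟨u, hadj.symm, ?_⟩
      have h1 := dist_le q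
      rw [Walk.length_cons, dist_comm] at hp
      rw [dist_comm] at h1
      rcases hT.dist_eq_dist_add_one_of_adj o hadj with h | h
      · exact h
      · omega
  choose! par hpar using h
  refine ⟨par, hpar, fun u v huv hd => ?_⟩
  have hv : v ≠ o := by
    rintro rfl
    simp at hd
  exact (hpar v hv).1.eq_of_dist_eq_add_one hT huv (hpar v hv).2 hd

theorem mem_graphBall_iff_dist [T.LocallyFinite] (hT : T.IsTree) (o v : V) (r : ℕ) :
    v ∈ graphBall T o r ↔ T.dist o v ≤ r := by
  rw [mem_graphBall]
  constructor
  · rintro ⟨p, hp⟩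
    exact (dist_le p).trans hp
  · intro h
    obtain ⟨p, hp⟩ := (hT.connected o v).exists_walk_length_eq_dist
    exact ⟨p, hp ▸ h⟩

theorem graphBall_mono [T.LocallyFinite] (hT : T.IsTree) (o : V) : Monotone (graphBall T o) :=
  fun r s h v hv => by
    rw [mem_graphBall_iff_dist hT] at hv ⊢
    exact hv.trans h

theorem exists_subset_graphBall [T.LocallyFinite] (hT : T.IsTree) (o : V) (S : Finset V) :
    ∃ R, S ⊆ graphBall T o R :=
  ⟨S.sup (T.dist o), fun _ hv => (mem_graphBall_iff_dist hT _ _ _).2 (Finset.le_sup hv)⟩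

theorem IsTree.countable [T.LocallyFinite] (hT : T.IsTree) : Countable V := by
  obtain ⟨o⟩ := hT.connected.nonempty
  have : (Set.univ : Set V) ⊆ ⋃ r, (graphBall T o r : Set V) := fun v _ =>
    Set.mem_iUnion.2 ⟨T.dist o v, (mem_graphBall_iff_dist hT _ _ _).2 le_rfl⟩
  exact Set.countable_univ_iff.1 ((Set.countable_iUnion fun r => Finset.countable_toSet _).mono this)

/-- The neighbours of `v` that are one step further away from `o`. -/
noncomputable def children (T : SimpleGraph V) [T.LocallyFinite] (o v : V) : Finset V :=
  (T.neighborFinset v).filter fun c => T.dist o c = T.dist o v + 1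

theorem mem_children [T.LocallyFinite] {o u c : V} :
    c ∈ T.children o u ↔ T.Adj u c ∧ T.dist o c = T.dist o u + 1 := by
  simp [children]

theorem card_children_le [T.LocallyFinite] {d : ℕ} (hd : T.IsRegularOfDegree d) (o v : V) :
    (T.children o v).card ≤ d :=
  (Finset.card_filter_le _ _).trans (hd v).le

theorem card_children [T.LocallyFinite] (hT : T.IsTree) {d : ℕ} (hd : T.IsRegularOfDegree d)
    {o v : V} (hv : v ≠ o) : (T.children o v).card = d - 1 := by
  classical
  obtain ⟨par, h1, h2⟩ := hT.exists_parent o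
  obtain ⟨ha, hl⟩ := h1 v hv
  have : T.children o v = (T.neighborFinset v).erase (par v) := by
    ext c
    rw [mem_children, Finset.mem_erase, mem_neighborFinset]
    constructor
    · rintro ⟨h, h'⟩
      refine ⟨?_, h⟩
      rintro rfl
      omega
    · rintro ⟨h, h'⟩
      refine ⟨h', ?_⟩
      rcases hT.dist_eq_dist_add_one_of_adj o h' with h3 | h3
      · exact absurd (h2 c v h'.symm h3).symm h
      · exact h3
  rw [this, Finset.card_erase_of_mem (by simpa using ha.symm), card_neighborFinset_eq_degree, hd v]

end SimpleGraph

end Trees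

/-! ### Summing out a ball sphere by sphere. -/

section BallRecursion

open Filter Topology MeasureTheory

namespace Interaction

theorem energy_addField_ne_bot {V A : Type*} {Φ : Interaction V A}
    (hΦ : ∀ F ξ, Φ.energy F ξ ≠ ⊥) (Ψ : V → A → ℝ) (F : Finset V) (ξ : F → A) :
    (Φ.addField Ψ).energy F ξ ≠ ⊥ :=
  WithBot.add_ne_bot.2 ⟨hΦ F ξ, WithBot.coe_ne_bot⟩

theorem addField_zero {V A : Type*} (Φ : Interaction V A) : Φ.addField (fun _ _ => 0) = Φ := by
  cases Φ
  simp [addField]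

theorem realEnergy_addField {V A : Type*} {Φ : Interaction V A}
    (hΦ : ∀ F ξ, Φ.energy F ξ ≠ ⊥) (Ψ : V → A → ℝ) (S : Finset V) (ω : V → A) :
    (Φ.addField Ψ).realEnergy S ω = Φ.realEnergy S ω + ∑ v ∈ S, Ψ v (ω v) := by
  classical
  set f : Finset V → ℝ := fun F => ∑ v : F, if F = {(v : V)} then Ψ v (ω v) else 0 with hf
  have hsing : ∀ v, f {v} = Ψ v (ω v) := fun v => by
    simp only [hf]
    rw [Finset.sum_coe_sort {v} (fun w => if ({v} : Finset V) = {w} then Ψ w (ω w) else 0)]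
    simp
  have hsupp : ∀ F ∈ Function.support f, ∃ v, F = {v} := fun F hF => by
    by_contra h
    push Not at h
    exact hF (Finset.sum_eq_zero fun v _ => if_neg (h v))
  have hsum : ∑ᶠ F ∈ {F : Finset V | ∃ v ∈ F, v ∈ S}, f F = ∑ v ∈ S, Ψ v (ω v) := by
    rw [finsum_mem_inter_support_eq' f _ ((fun v => ({v} : Finset V)) '' (S : Set V)),
      finsum_mem_image (Finset.singleton_injective.injOn), finsum_mem_coe_finset]
    · exact Finset.sum_congr rfl fun v _ => hsing v
    · intro F hF
      obtain ⟨v, rfl⟩ := hsupp F hF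
      simp
  rw [← hsum]
  unfold realEnergy
  rw [← finsum_mem_add_distrib' (Φ.finite_inter_support S ω subset_rfl)]
  · refine finsum_mem_congr rfl fun F _ => ?_
    obtain ⟨x, hx⟩ := WithBot.ne_bot_iff_exists.1 (hΦ F (F.restrict ω))
    simp only [addField]
    rw [← hx, ← WithBot.coe_add]
    simp only [WithBot.unbotD_coe, hf]
    rfl
  · refine ((S.finite_toSet.image fun v => ({v} : Finset V))).subset ?_
    rintro F ⟨⟨w, hw, hS⟩, hF⟩
    obtain ⟨v, rfl⟩ := hsupp F hF
    exact ⟨v, by simpa using (Finset.mem_singleton.1 hw) ▸ hS, rfl⟩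

end Interaction

section Sums

variable {V A : Type*} [Fintype A]

theorem sumOut_congr {S : Finset V} {f g : (V → A) → ℝ} {η : V → A}
    (h : ∀ ξ : S → A, f (glue S ξ η) = g (glue S ξ η)) : sumOut S f η = sumOut S g η :=
  Finset.sum_congr rfl fun ξ _ => h ξ

theorem sumOut_prod (S : Finset V) (f : V → A → ℝ) (η : V → A) :
    sumOut S (fun ω => ∏ v ∈ S, f v (ω v)) η = ∏ v ∈ S, ∑ t, f v t := by
  classical
  rw [sumOut_def, ← Finset.prod_coe_sort, Finset.prod_univ_sum, Fintype.piFinset_univ]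
  refine Finset.sum_congr rfl fun ξ _ => ?_
  rw [← Finset.prod_coe_sort]
  exact Finset.prod_congr rfl fun v _ => by rw [glue_of_mem v.2]

end Sums

section Tree

open SimpleGraph

variable {V : Type*} {T : SimpleGraph V}

/-- A choice of the neighbour of each vertex that is closer to `o`. -/
structure IsParent (T : SimpleGraph V) (o : V) (par : V → V) : Prop where
  adj : ∀ v, v ≠ o → T.Adj (par v) v
  dist : ∀ v, v ≠ o → T.dist o v = T.dist o (par v) + 1
  eq : ∀ u v, T.Adj u v → T.dist o v = T.dist o u + 1 → par v = u

theorem exists_isParent (hT : T.IsTree) (o : V) : ∃ par, IsParent T o par := by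
  obtain ⟨par, h1, h2⟩ := hT.exists_parent o
  exact ⟨par, fun v hv => (h1 v hv).1, fun v hv => (h1 v hv).2, h2⟩

theorem ne_root_of_dist {o v : V} {r : ℕ} (h : T.dist o v = r + 1) : v ≠ o := by
  rintro rfl
  simp at h

variable [T.LocallyFinite]

/-- The vertices at distance exactly `r` from `o`. -/
noncomputable def graphSphere (T : SimpleGraph V) [T.LocallyFinite] (o : V) (r : ℕ) : Finset V :=
  (graphBall T o r).filter fun v => T.dist o v = r

theorem mem_graphSphere (hT : T.IsTree) {o v : V} {r : ℕ} :
    v ∈ graphSphere T o r ↔ T.dist o v = r := by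
  simp only [graphSphere, Finset.mem_filter, mem_graphBall_iff_dist hT]
  omega

theorem mem_graphBall_succ (hT : T.IsTree) {o v : V} {r : ℕ} :
    v ∈ graphBall T o (r + 1) ↔ v ∈ graphBall T o r ∨ v ∈ graphSphere T o (r + 1) := by
  rw [mem_graphSphere hT, mem_graphBall_iff_dist hT, mem_graphBall_iff_dist hT]
  omega

theorem disjoint_graphBall_graphSphere (hT : T.IsTree) (o : V) (r : ℕ) :
    Disjoint (graphBall T o r) (graphSphere T o (r + 1)) :=
  Finset.disjoint_left.2 fun v h h' => by
    rw [mem_graphBall_iff_dist hT] at h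
    rw [mem_graphSphere hT] at h'
    omega

/-- The sphere is grouped by parents. The sum over the whole ball with a conditional has the shape
of the field update in `rootField`. -/
theorem sum_graphSphere (hT : T.IsTree) {o : V} {par : V → V} (hp : IsParent T o par) (r : ℕ)
    (F : V → V → ℝ) :
    ∑ v ∈ graphSphere T o (r + 1), F (par v) v =
      ∑ u ∈ graphBall T o r, if T.dist o u = r then ∑ c ∈ T.children o u, F u c else 0 := by
  classical
  rw [← Finset.sum_fiberwise_of_maps_to (s := graphSphere T o (r + 1)) (t := graphBall T o r)
    (g := par)]
  · refine Finset.sum_congr rfl fun u _ => ?_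
    split_ifs with hu
    · have : (graphSphere T o (r + 1)).filter (fun v => par v = u) = T.children o u := by
        ext c
        rw [Finset.mem_filter, mem_graphSphere hT, mem_children, hu]
        constructor
        · rintro ⟨h, rfl⟩
          exact ⟨hp.adj c (ne_root_of_dist h), h⟩
        · rintro ⟨h, h'⟩
          exact ⟨h', hp.eq u c h (by omega)⟩
      rw [← this]
      exact Finset.sum_congr rfl fun v hv => by rw [(Finset.mem_filter.1 hv).2]
    · refine Finset.sum_eq_zero fun v hv => absurd ?_ hu
      obtain ⟨h, rfl⟩ := Finset.mem_filter.1 hv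
      rw [mem_graphSphere hT] at h
      have := hp.dist v (ne_root_of_dist h)
      omega
  · intro v hv
    rw [mem_graphSphere hT] at hv
    have := hp.dist v (ne_root_of_dist hv)
    rw [mem_graphBall_iff_dist hT]
    omega

theorem isingInteraction_ne_bot (β : ℝ) (F : Finset V) (ξ : F → ℤˣ) :
    (isingInteraction T β).energy F ξ ≠ ⊥ := by
  classical
  simp only [isingInteraction]
  split_ifs
  · exact WithBot.coe_ne_bot
  · exact WithBot.coe_ne_bot

/-- The spin of `v`, as a real number. -/
def spin (ω : V → ℤˣ) (v : V) : ℝ := ((ω v : ℤ) : ℝ)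

open Classical in
theorem realEnergy_isingInteraction_graphBall (hT : T.IsTree) {o : V} {par : V → V}
    (hp : IsParent T o par) (β : ℝ) (r : ℕ) (ω : V → ℤˣ) :
    (isingInteraction T β).realEnergy (graphBall T o r) ω =
      ∑ v ∈ (graphBall T o (r + 1)).erase o, β * (spin ω v * spin ω (par v)) := by
  unfold Interaction.realEnergy
  rw [finsum_mem_inter_support_eq' _ _
    ((fun v => ({v, par v} : Finset V)) '' ((graphBall T o (r + 1)).erase o : Finset V)),
    finsum_mem_image, finsum_mem_coe_finset]
  · refine Finset.sum_congr rfl fun v hv => ?_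
    have hv' : v ≠ o := (Finset.mem_erase.1 hv).1
    have hadj := hp.adj v hv'
    simp only [isingInteraction]
    rw [if_pos ⟨v, par v, hadj.symm, rfl⟩, WithBot.unbotD_coe]
    congr 1
    refine (Finset.prod_coe_sort {v, par v} (spin ω)).trans ?_
    exact Finset.prod_pair hadj.ne'
  -- If two distinct vertices gave the same edge, each would be the parent of the other.
  · intro v hv w hw h
    simp only [Finset.coe_erase, Set.mem_sdiff, Set.mem_singleton_iff] at hv hw h
    by_contra hne
    have h1 : v ∈ ({w, par w} : Finset V) := h ▸ Finset.mem_insert_self v _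
    have h2 : w ∈ ({v, par v} : Finset V) := h ▸ Finset.mem_insert_self w _
    simp only [Finset.mem_insert, Finset.mem_singleton, hne, Ne.symm hne, false_or] at h1 h2
    have h3 := hp.dist v hv.2
    have h4 := hp.dist w hw.2
    rw [← h2] at h3
    rw [← h1] at h4
    omega
  · intro F hF
    have hF' : ∃ u v, T.Adj u v ∧ F = {u, v} := by
      by_contra h
      refine hF ?_
      simp only [isingInteraction]
      rw [if_neg h]
      rfl
    have hex : ∃ v, v ≠ o ∧ F = {v, par v} := by
      obtain ⟨u, v, huv, rfl⟩ := hF'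
      rcases hT.dist_eq_dist_add_one_of_adj o huv with h | h
      · exact ⟨u, ne_root_of_dist h, by rw [hp.eq v u huv.symm h]⟩
      · exact ⟨v, ne_root_of_dist h, by rw [hp.eq u v huv h, Finset.pair_comm]⟩
    -- An edge meets the ball exactly when its inner endpoint lies in it, so the outer endpoint
    -- ranges up to radius r + 1.
    have hiff : ∀ v, v ≠ o → ((∃ w ∈ ({v, par v} : Finset V), w ∈ graphBall T o r) ↔
        v ∈ graphBall T o (r + 1)) := fun v hv => by
      have := hp.dist v hv
      simp only [Finset.mem_insert, Finset.mem_singleton, mem_graphBall_iff_dist hT,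
        exists_eq_or_imp, exists_eq_left]
      omega
    constructor
    · rintro h
      obtain ⟨v, hv, rfl⟩ := hex
      exact ⟨v, by simpa [hv] using (hiff v hv).1 h, rfl⟩
    · rintro ⟨v, hv, rfl⟩
      simp only [Finset.coe_erase, Set.mem_sdiff, Set.mem_singleton_iff, Finset.mem_coe] at hv
      exact (hiff v hv.2).2 hv.1

open Classical in
/-- The Boltzmann weight of the Ising model on a ball with free boundary and external field `h`. -/
noncomputable def freeWeight (T : SimpleGraph V) [T.LocallyFinite] (o : V) (par : V → V) (β : ℝ)
    (h : V → ℝ) (r : ℕ) (ω : V → ℤˣ) : ℝ :=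
  Real.exp (∑ v ∈ (graphBall T o r).erase o, β * (spin ω v * spin ω (par v)) +
    ∑ v ∈ graphBall T o r, h v * spin ω v)

/-- The effective field at the root, obtained by successively summing out the spheres. -/
noncomputable def rootField (T : SimpleGraph V) [T.LocallyFinite] (o : V) (β : ℝ) :
    ℕ → (V → ℝ) → ℝ
  | 0, h => h o
  | r + 1, h => rootField T o β r fun v =>
      h v + if T.dist o v = r then ∑ c ∈ T.children o v, edgeMessage β (h c) else 0

open Classical in
theorem erase_graphBall_succ (hT : T.IsTree) (o : V) (r : ℕ) :
    (graphBall T o (r + 1)).erase o = (graphBall T o r).erase o ∪ graphSphere T o (r + 1) := by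
  ext v
  rw [Finset.mem_union, Finset.mem_erase, Finset.mem_erase, mem_graphBall_succ hT]
  have : v ∈ graphSphere T o (r + 1) → v ≠ o := fun h =>
    ne_root_of_dist ((mem_graphSphere hT).1 h)
  tauto

open Classical in
theorem sum_erase_graphBall_succ (hT : T.IsTree) (o : V) (r : ℕ) (f : V → ℝ) :
    ∑ v ∈ (graphBall T o (r + 1)).erase o, f v =
      ∑ v ∈ (graphBall T o r).erase o, f v + ∑ v ∈ graphSphere T o (r + 1), f v := by
  rw [erase_graphBall_succ hT, Finset.sum_union]
  exact (disjoint_graphBall_graphSphere hT o r).mono_left (Finset.erase_subset _ _)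

theorem sum_graphBall_succ (hT : T.IsTree) (o : V) (r : ℕ) (f : V → ℝ) :
    ∑ v ∈ graphBall T o (r + 1), f v =
      ∑ v ∈ graphBall T o r, f v + ∑ v ∈ graphSphere T o (r + 1), f v := by
  classical
  rw [← Finset.sum_union (disjoint_graphBall_graphSphere hT o r)]
  refine Finset.sum_congr ?_ fun _ _ => rfl
  ext v
  rw [Finset.mem_union, mem_graphBall_succ hT]

theorem freeWeight_succ (hT : T.IsTree) (o : V) (par : V → V) (β : ℝ) (h : V → ℝ) (r : ℕ)
    (ω : V → ℤˣ) :
    freeWeight T o par β h (r + 1) ω = freeWeight T o par β h r ω *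
      ∏ v ∈ graphSphere T o (r + 1), Real.exp (spin ω v * (β * spin ω (par v) + h v)) := by
  unfold freeWeight
  rw [← Real.exp_sum, ← Real.exp_add, sum_erase_graphBall_succ hT, sum_graphBall_succ hT]
  have : ∑ v ∈ graphSphere T o (r + 1), spin ω v * (β * spin ω (par v) + h v) =
      ∑ v ∈ graphSphere T o (r + 1), β * (spin ω v * spin ω (par v)) +
        ∑ v ∈ graphSphere T o (r + 1), h v * spin ω v := by
    rw [← Finset.sum_add_distrib]
    exact Finset.sum_congr rfl fun v _ => by ring
  rw [this]
  ring_nf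

theorem spin_glue_graphSphere (hT : T.IsTree) {o v : V} {r : ℕ} (hv : T.dist o v ≤ r)
    (ξ : graphSphere T o (r + 1) → ℤˣ) (η : V → ℤˣ) :
    spin (glue (graphSphere T o (r + 1)) ξ η) v = spin η v := by
  unfold spin
  rw [glue_of_notMem]
  rw [mem_graphSphere hT]
  omega

theorem freeWeight_glue (hT : T.IsTree) {o : V} {par : V → V} (hp : IsParent T o par) (β : ℝ)
    (h : V → ℝ) (r : ℕ) (ξ : graphSphere T o (r + 1) → ℤˣ) (η : V → ℤˣ) :
    freeWeight T o par β h r (glue (graphSphere T o (r + 1)) ξ η) =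
      freeWeight T o par β h r η := by
  classical
  unfold freeWeight
  congr 2
  · refine Finset.sum_congr rfl fun v hv => ?_
    rw [Finset.mem_erase, mem_graphBall_iff_dist hT] at hv
    have := hp.dist v hv.1
    rw [spin_glue_graphSphere hT hv.2, spin_glue_graphSphere hT (by omega)]
  · refine Finset.sum_congr rfl fun v hv => ?_
    rw [mem_graphBall_iff_dist hT] at hv
    rw [spin_glue_graphSphere hT hv]

/-- Summing out the outermost sphere changes the field on the next sphere. -/
theorem exists_sumOut_freeWeight_succ (hT : T.IsTree) {o : V} {par : V → V}
    (hp : IsParent T o par) (β : ℝ) (h : V → ℝ) (r : ℕ) : ∃ C : ℝ, 0 < C ∧ ∀ ω,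
      sumOut (graphSphere T o (r + 1)) (freeWeight T o par β h (r + 1)) ω =
        C * freeWeight T o par β (fun v => h v +
          if T.dist o v = r then ∑ c ∈ T.children o v, edgeMessage β (h c) else 0) r ω := by
  refine ⟨∏ v ∈ graphSphere T o (r + 1), 2 * Real.exp ((Real.log (Real.cosh (h v + β)) +
    Real.log (Real.cosh (h v - β))) / 2), Finset.prod_pos fun v _ => by positivity, fun ω => ?_⟩
  -- Given the inner ball, the spins on the sphere are independent, so the sum becomes a product
  -- over the sphere.
  rw [funext (freeWeight_succ hT o par β h r),
    sumOut_mul_left (fun ξ η => freeWeight_glue hT hp β h r ξ η),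
    sumOut_congr (g := fun ω' : V → ℤˣ => ∏ v ∈ graphSphere T o (r + 1),
      Real.exp (((ω' v : ℤ) : ℝ) * (β * ((ω (par v) : ℤ) : ℝ) + h v)))]
  · rw [sumOut_prod _ (fun v (t : ℤˣ) => Real.exp (((t : ℤ) : ℝ) * (β * ((ω (par v) : ℤ) : ℝ) + h v)))]
    simp only [sum_exp_edge]
    rw [Finset.prod_mul_distrib, ← Real.exp_sum, mul_left_comm]
    congr 1
    unfold freeWeight
    rw [← Real.exp_add, sum_graphSphere hT hp r
      (fun u v => ((ω u : ℤ) : ℝ) * edgeMessage β (h v)), add_assoc, ← Finset.sum_add_distrib]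
    congr 2
    refine Finset.sum_congr rfl fun v _ => ?_
    beta_reduce
    split_ifs
    · rw [add_mul, Finset.sum_mul]
      congr 1
      exact Finset.sum_congr rfl fun c _ => mul_comm _ _
    · rw [add_zero, add_zero]
  · intro ξ
    refine Finset.prod_congr rfl fun v hv => ?_
    rw [mem_graphSphere hT] at hv
    have := hp.dist v (ne_root_of_dist hv)
    rw [spin_glue_graphSphere (v := par v) hT (by omega)]
    rfl

open Classical in
-- Since C depends neither on a nor on η, it cancels in the marginal of the root. The field is
-- quantified inside the induction because every summation changes it.
theorem exists_sumOut_freeWeight (hT : T.IsTree) {o : V} {par : V → V}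
    (hp : IsParent T o par) (β : ℝ) (r : ℕ) : ∀ h : V → ℝ, ∃ C : ℝ, 0 < C ∧ ∀ (a : ℤˣ) η,
      sumOut (graphBall T o r)
        (fun ω => (if ω o = a then 1 else 0) * freeWeight T o par β h r ω) η =
        C * Real.exp (((a : ℤ) : ℝ) * rootField T o β r h) := by
  induction r with
  | zero =>
    intro h
    refine ⟨1, one_pos, fun a η => ?_⟩
    have := sumOut_prod {o} (fun v t => (if t = a then 1 else 0) *
      Real.exp (h v * ((t : ℤ) : ℝ))) η
    simp only [Finset.prod_singleton] at this
    simp only [graphBall, freeWeight, Finset.erase_singleton, Finset.sum_empty, zero_add,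
      Finset.sum_singleton, spin, rootField, one_mul, this]
    rw [Finset.sum_eq_single a (fun b _ hb => by simp [hb])
      fun h => absurd (Finset.mem_univ a) h]
    simp [mul_comm]
  | succ r ih =>
    intro h
    obtain ⟨C, hC, hs⟩ := exists_sumOut_freeWeight_succ hT hp β h r
    obtain ⟨C', hC', hs'⟩ := ih fun v => h v +
      if T.dist o v = r then ∑ c ∈ T.children o v, edgeMessage β (h c) else 0
    refine ⟨C * C', mul_pos hC hC', fun a η => ?_⟩
    rw [sumOut_union (disjoint_graphBall_graphSphere hT o r) (fun v => mem_graphBall_succ hT),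
      rootField, mul_assoc, ← hs' a η]
    rw [← sumOut_mul_left (c := fun _ => C) (fun _ _ => rfl)]
    congr 1
    funext ω
    rw [sumOut_mul_left (c := fun ω : V → ℤˣ => if ω o = a then (1 : ℝ) else 0), hs]
    · ring
    · intro ξ η
      rw [glue_of_notMem]
      rw [mem_graphSphere hT]
      simp

/-- The field on a ball that represents an external field and a boundary condition. -/
noncomputable def boundaryField (T : SimpleGraph V) [T.LocallyFinite] (o : V) (β : ℝ)
    (Ψ : V → ℤˣ → ℝ) (η : V → ℤˣ) (r : ℕ) (v : V) : ℝ :=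
  (Ψ v 1 - Ψ v (-1)) / 2 + if T.dist o v = r then ∑ c ∈ T.children o v, β * spin η c else 0

theorem exp_realEnergy_glue (hT : T.IsTree) {o : V} {par : V → V} (hp : IsParent T o par) (β : ℝ)
    (Ψ : V → ℤˣ → ℝ) (η : V → ℤˣ) (r : ℕ) (ξ : graphBall T o r → ℤˣ) :
    Real.exp (((isingInteraction T β).addField Ψ).realEnergy (graphBall T o r)
        (glue (graphBall T o r) ξ η)) =
      Real.exp (∑ v ∈ graphBall T o r, (Ψ v 1 + Ψ v (-1)) / 2) *
        freeWeight T o par β (boundaryField T o β Ψ η r) r (glue (graphBall T o r) ξ η) := by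
  classical
  rw [Interaction.realEnergy_addField (isingInteraction_ne_bot β),
    realEnergy_isingInteraction_graphBall hT hp, sum_erase_graphBall_succ hT]
  unfold freeWeight
  rw [← Real.exp_add]
  congr 1
  set ω := glue (graphBall T o r) ξ η with hω
  -- Spins on the sphere of radius r + 1 are frozen by η, so its edges act as fields on the sphere
  -- of radius r.
  have h1 : ∑ v ∈ graphSphere T o (r + 1), β * (spin ω v * spin ω (par v)) =
      ∑ v ∈ graphSphere T o (r + 1), β * (spin η v * spin ω (par v)) :=
    Finset.sum_congr rfl fun v hv => by
      have : spin ω v = spin η v := by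
        unfold spin
        rw [hω, glue_of_notMem fun h =>
          Finset.disjoint_left.1 (disjoint_graphBall_graphSphere hT o r) h hv]
      rw [this]
  rw [h1, sum_graphSphere hT hp r (fun u v => β * (spin η v * spin ω u)), add_assoc,
    add_left_comm (∑ v ∈ graphBall T o r, (Ψ v 1 + Ψ v (-1)) / 2), ← Finset.sum_add_distrib,
    ← Finset.sum_add_distrib]
  congr 1
  refine Finset.sum_congr rfl fun v _ => ?_
  -- Every function of a sign is affine in it; the constant part goes into the prefactor.
  have h2 : Ψ v (ω v) = (Ψ v 1 + Ψ v (-1)) / 2 + (Ψ v 1 - Ψ v (-1)) / 2 * spin ω v := by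
    unfold spin
    rcases Int.units_eq_one_or (ω v) with h | h <;> rw [h] <;> push_cast <;> ring
  rw [h2, boundaryField]
  split_ifs
  · rw [add_mul, Finset.sum_mul]
    simp only [mul_assoc]
    ring
  · ring

theorem condMarginal_graphBall (hT : T.IsTree) (o : V) (β : ℝ)
    (Ψ : V → ℤˣ → ℝ) (η : V → ℤˣ) (r : ℕ) (a : ℤˣ) :
    ((isingInteraction T β).addField Ψ).condMarginal (graphBall T o r) η o a =
      (1 + Real.exp (-(2 *
        (((a : ℤ) : ℝ) * rootField T o β r (boundaryField T o β Ψ η r)))))⁻¹ := by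
  classical
  obtain ⟨par, hp⟩ := exists_isParent hT o
  obtain ⟨C, hC, hs⟩ := exists_sumOut_freeWeight hT hp β r (boundaryField T o β Ψ η r)
  set L := rootField T o β r (boundaryField T o β Ψ η r)
  set D := Real.exp (∑ v ∈ graphBall T o r, (Ψ v 1 + Ψ v (-1)) / 2)
  rw [Interaction.condMarginal_eq
    (Interaction.energy_addField_ne_bot (isingInteraction_ne_bot β) Ψ)]
  have h1 : ∀ b : ℤˣ, sumOut (graphBall T o r) (fun ω => Real.exp
      (((isingInteraction T β).addField Ψ).realEnergy (graphBall T o r) ω) *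
        if ω o = b then 1 else 0) η = D * C * Real.exp (((b : ℤ) : ℝ) * L) := fun b => by
    rw [mul_assoc, ← hs b η, ← sumOut_mul_left (c := fun _ => D) (fun _ _ => rfl)]
    refine sumOut_congr fun ξ => ?_
    rw [exp_realEnergy_glue hT hp]
    ring
  have h2 : sumOut (graphBall T o r) (fun ω => Real.exp
      (((isingInteraction T β).addField Ψ).realEnergy (graphBall T o r) ω)) η =
        D * C * Real.exp (((a : ℤ) : ℝ) * L) + D * C * Real.exp (((-a : ℤˣ) : ℤ) * L) := by
    rw [← h1, ← h1]
    simp only [sumOut, ← Finset.sum_add_distrib]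
    refine Finset.sum_congr rfl fun ξ _ => ?_
    rw [← mul_add]
    have : ∀ b : ℤˣ, ((if b = a then 1 else 0) + (if b = -a then 1 else 0) : ℝ) = 1 := by
      intro b
      rcases Int.units_eq_one_or b with rfl | rfl <;>
        rcases Int.units_eq_one_or a with rfl | rfl <;> norm_num [units_ne_neg_self]
    rw [this, mul_one]
  refine Eq.trans (b := D * C * Real.exp (((a : ℤ) : ℝ) * L) / (D * C * Real.exp (((a : ℤ) : ℝ) * L) +
    D * C * Real.exp (((-a : ℤˣ) : ℤ) * L))) (by rw [← h2, ← h1 a]; congr!) ?_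
  rw [← mul_add, mul_div_mul_left _ _ (mul_pos (Real.exp_pos _) hC).ne']
  have h3 : Real.exp (((-a : ℤˣ) : ℤ) * L) =
      Real.exp (((a : ℤ) : ℝ) * L) * Real.exp (-(2 * (((a : ℤ) : ℝ) * L))) := by
    rw [← Real.exp_add]
    congr 1
    push_cast
    ring
  rw [h3]
  have := Real.exp_pos (((a : ℤ) : ℝ) * L)
  have := Real.exp_pos (-(2 * (((a : ℤ) : ℝ) * L)))
  field_simp

end Tree

end BallRecursion

/-! ### The two sides of the threshold (d - 1) tanh β = 1. -/

section Mixing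

open Filter Topology MeasureTheory
open SimpleGraph

section RootField

variable {V : Type*} {T : SimpleGraph V} [T.LocallyFinite]

theorem le_card_children (hT : T.IsTree) {d : ℕ} (hd : T.IsRegularOfDegree d) (o v : V) :
    d - 1 ≤ (T.children o v).card := by
  by_cases hv : v = o
  · subst hv
    have : T.children v v = T.neighborFinset v := by
      refine Finset.filter_true_of_mem fun c hc => ?_
      rw [dist_self, zero_add, dist_eq_one_iff_adj]
      simpa using hc
    rw [this, card_neighborFinset_eq_degree, hd v]
    exact Nat.sub_le _ _
  · exact (card_children hT hd hv).ge

theorem abs_sum_children_sub_le {β : ℝ} (hβ : 0 ≤ β) {o v : V} {n : ℕ}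
    (hn : (T.children o v).card ≤ n) {h h' : V → ℝ} {x : ℝ} (hx : 0 ≤ x)
    (hh : ∀ c ∈ T.children o v, |h c - h' c| ≤ 2 * x) :
    |∑ c ∈ T.children o v, edgeMessage β (h c) - ∑ c ∈ T.children o v, edgeMessage β (h' c)| ≤
      2 * (n * edgeMessage β x) := by
  rw [← Finset.sum_sub_distrib]
  refine (Finset.abs_sum_le_sum_abs _ _).trans ?_
  refine (Finset.sum_le_card_nsmul _ _ _ fun c hc => abs_edgeMessage_sub_le hβ (hh c hc)).trans ?_
  have h1 : ((T.children o v).card : ℝ) ≤ n := Nat.cast_le.2 hn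
  have h2 := edgeMessage_nonneg hβ hx
  rw [nsmul_eq_mul]
  nlinarith

/-- The influence of fields on the sphere of radius `r + 1` on the root is dominated by that in
the model without further fields. -/
theorem abs_rootField_sub_le (hT : T.IsTree) {d : ℕ} (hd : T.IsRegularOfDegree d) (o : V) {β : ℝ}
    (hβ : 0 ≤ β) (r : ℕ) : ∀ (h h' : V → ℝ) (x : ℝ), 0 ≤ x →
      (∀ v, T.dist o v < r + 1 → h v = h' v) →
      (∀ v, T.dist o v = r + 1 → |h v - h' v| ≤ 2 * x) →
      |rootField T o β (r + 1) h - rootField T o β (r + 1) h'| ≤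
        2 * (d * edgeMessage β ((fun y => ((d - 1 : ℕ) : ℝ) * edgeMessage β y)^[r] x)) := by
  induction r with
  | zero =>
    intro h h' x hx heq hle
    have := abs_sum_children_sub_le hβ (card_children_le hd o o) hx fun c hc =>
      hle c (by simpa using (mem_children.1 hc).2)
    simpa [rootField, heq o (by simp)] using this
  | succ r ih =>
    intro h h' x hx heq hle
    -- Summing out the last sphere moves the discrepancy one sphere inwards and replaces x by (d -
    -- 1) φ(x). Only the root may have d children, hence the single outer factor d.
    rw [Function.iterate_succ_apply]
    change |rootField T o β (r + 1) _ - rootField T o β (r + 1) _| ≤ _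
    refine ih _ _ _ (mul_nonneg (Nat.cast_nonneg _) (edgeMessage_nonneg hβ hx)) ?_ ?_
    · intro v hv
      rw [if_neg hv.ne, if_neg hv.ne, heq v (by omega)]
    · intro v hv
      rw [if_pos hv, if_pos hv, heq v (by omega), add_sub_add_left_eq_sub]
      refine abs_sum_children_sub_le hβ (card_children hT hd (ne_root_of_dist hv)).le hx
        fun c hc => hle c ?_
      rw [(mem_children.1 hc).2, hv]

/-- Each vertex of the next sphere receives at least d - 1 messages of sign s and size at least
φ(x), and `hxg` restores the bound x. Oddness of φ treats both signs at once. -/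
theorem le_mul_rootField (hT : T.IsTree) {d : ℕ} (hd : T.IsRegularOfDegree d) (o : V) {β : ℝ}
    (hβ : 0 ≤ β) {x : ℝ} (hx : 0 ≤ x) (hxg : x ≤ ((d - 1 : ℕ) : ℝ) * edgeMessage β x) (s : ℤˣ)
    (r : ℕ) : ∀ h : V → ℝ, (∀ v, T.dist o v < r → h v = 0) →
      (∀ v, T.dist o v = r → x ≤ ((s : ℤ) : ℝ) * h v) →
      x ≤ ((s : ℤ) : ℝ) * rootField T o β r h := by
  induction r with
  | zero => exact fun h _ hle => hle o (by simp)
  | succ r ih =>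
    intro h h0 hle
    refine ih _ (fun v hv => ?_) fun v hv => ?_
    · rw [if_neg hv.ne, h0 v (by omega), add_zero]
    · rw [if_pos hv, h0 v (by omega), zero_add, Finset.mul_sum]
      refine hxg.trans ?_
      have h1 : ((T.children o v).card : ℝ) * edgeMessage β x ≤
          ∑ c ∈ T.children o v, ((s : ℤ) : ℝ) * edgeMessage β (h c) := by
        rw [← nsmul_eq_mul]
        refine Finset.card_nsmul_le_sum _ _ _ fun c hc => ?_
        rw [← edgeMessage_unit_mul]
        exact edgeMessage_mono hβ (hle c (by rw [(mem_children.1 hc).2, hv]))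
      refine le_trans ?_ h1
      exact mul_le_mul_of_nonneg_right (Nat.cast_le.2 (le_card_children hT hd o v))
        (edgeMessage_nonneg hβ hx)

theorem abs_inv_one_add_exp_sub_le (x y : ℝ) :
    |(1 + Real.exp (-(2 * x)))⁻¹ - (1 + Real.exp (-(2 * y)))⁻¹| ≤ 2 * |x - y| := by
  wlog hxy : y ≤ x generalizing x y
  · rw [abs_sub_comm, abs_sub_comm x]
    exact this y x (le_of_not_ge hxy)
  have e1 := Real.exp_pos (-(2 * x))
  have e2 := Real.exp_pos (-(2 * y))
  have e3 : Real.exp (-(2 * x)) = Real.exp (-(2 * y)) * Real.exp (-(2 * (x - y))) := by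
    rw [← Real.exp_add]; ring_nf
  have e4 := Real.add_one_le_exp (-(2 * (x - y)))
  have e5 : Real.exp (-(2 * x)) ≤ Real.exp (-(2 * y)) := Real.exp_le_exp.2 (by linarith)
  rw [abs_of_nonneg (sub_nonneg.2 hxy), abs_of_nonneg (sub_nonneg.2 (by gcongr)),
    inv_sub_inv (by positivity) (by positivity), div_le_iff₀ (by positivity)]
  have e6 : 0 ≤ 2 * (x - y) := by linarith
  calc 1 + Real.exp (-(2 * y)) - (1 + Real.exp (-(2 * x)))
      = Real.exp (-(2 * y)) * (1 - Real.exp (-(2 * (x - y)))) := by rw [e3]; ring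
    _ ≤ Real.exp (-(2 * y)) * (2 * (x - y)) := by gcongr; linarith
    _ = 2 * (x - y) * Real.exp (-(2 * y)) := mul_comm _ _
    _ ≤ 2 * (x - y) * ((1 + Real.exp (-(2 * x))) * (1 + Real.exp (-(2 * y)))) := by
        gcongr
        nlinarith

end RootField

section Ising

variable {V : Type*} {T : SimpleGraph V} [T.LocallyFinite]

theorem abs_spin (η : V → ℤˣ) (v : V) : |spin η v| = 1 := by
  unfold spin
  rcases Int.units_eq_one_or (η v) with h | h <;> simp [h]

theorem inv_one_add_exp_le_condMarginal (hT : T.IsTree) {d : ℕ} (hd : T.IsRegularOfDegree d)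
    (o : V) {β : ℝ} (hβ : 0 ≤ β) {x : ℝ} (hx : 0 ≤ x)
    (hxg : x ≤ ((d - 1 : ℕ) : ℝ) * edgeMessage β x) (s : ℤˣ) (r : ℕ) :
    (1 + Real.exp (-(2 * x)))⁻¹ ≤
      (isingInteraction T β).condMarginal (graphBall T o r) (fun _ => s) o s := by
  have hs : ((s : ℤ) : ℝ) * ((s : ℤ) : ℝ) = 1 := by
    rcases Int.units_eq_one_or s with rfl | rfl <;> simp
  rw [← Interaction.addField_zero (isingInteraction T β), condMarginal_graphBall hT]
  -- The boundary gives a field of sign s and size at least (d - 1) β ≥ (d - 1) φ(x) ≥ x.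
  have := le_mul_rootField hT hd o hβ hx hxg s r
    (boundaryField T o β (fun _ _ => 0) (fun _ => s) r)
    (fun v hv => by simp [boundaryField, hv.ne]) (fun v hv => by
      have h1 : ((d - 1 : ℕ) : ℝ) ≤ (T.children o v).card :=
        Nat.cast_le.2 (le_card_children hT hd o v)
      have h2 : ((d - 1 : ℕ) : ℝ) * edgeMessage β x ≤ ((d - 1 : ℕ) : ℝ) * β :=
        mul_le_mul_of_nonneg_left (edgeMessage_le hβ x) (Nat.cast_nonneg _)
      have h3 : ((d - 1 : ℕ) : ℝ) * β ≤ (T.children o v).card * β :=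
        mul_le_mul_of_nonneg_right h1 hβ
      simp only [boundaryField, if_pos hv, spin, Finset.sum_const, nsmul_eq_mul, sub_self, zero_div,
        zero_add]
      calc x ≤ (T.children o v).card * β := by linarith
        _ = (T.children o v).card * β * (((s : ℤ) : ℝ) * ((s : ℤ) : ℝ)) := by rw [hs, mul_one]
        _ = _ := by ring)
  gcongr

theorem tanh_le_tanh_of_le {x y : ℝ} (h : x ≤ y) : Real.tanh x ≤ Real.tanh y := by
  rw [Real.tanh_eq_sinh_div_cosh, Real.tanh_eq_sinh_div_cosh,
    div_le_div_iff₀ (Real.cosh_pos x) (Real.cosh_pos y)]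
  have := Real.sinh_nonneg_iff.2 (sub_nonneg.2 h)
  rw [Real.sinh_sub] at this
  linarith

theorem mul_tanh_le_one_of_hasUniqueGibbsState (hT : T.IsTree) {d : ℕ}
    (hd : T.IsRegularOfDegree d) {β : ℝ} (hβ : 0 ≤ β)
    (hu : (isingInteraction T β).HasUniqueGibbsState) :
    ((d - 1 : ℕ) : ℝ) * Real.tanh β ≤ 1 := by
  by_contra! hlt
  obtain ⟨x, hx, hxg⟩ := exists_le_edgeMessage hlt
  obtain ⟨o⟩ := hT.connected.nonempty
  have := hT.countable
  -- The measurable structure of the units is pulled back from ℤ; both σ-algebras contain every set.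
  have hborel : BorelSpace ℤˣ := ⟨by
    have h1 : ∀ s : Set ℤˣ, MeasurableSet s := fun s => by
      refine ⟨Units.val '' s, trivial, ?_⟩
      exact Set.preimage_image_eq _ Units.val_injective
    have h2 : ∀ s : Set ℤˣ, MeasurableSet[borel ℤˣ] s := fun s =>
      MeasurableSpace.measurableSet_generateFrom (isOpen_discrete s)
    exact MeasurableSpace.ext fun s => iff_of_true (h1 s) (h2 s)⟩
  have hex : ∀ s : ℤˣ, ∃ μ, (isingInteraction T β).IsGibbsState μ ∧
      (1 + Real.exp (-(2 * x)))⁻¹ ≤ μ.real {σ | σ o = s} := fun s => by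
    obtain ⟨μ, hμ, h⟩ := Interaction.exists_isGibbsState (isingInteraction_ne_bot (T := T) β)
      (graphBall_mono hT o) (exists_subset_graphBall hT o) (fun _ => s)
    exact ⟨μ, hμ, h o s _ (Eventually.of_forall fun r =>
      inv_one_add_exp_le_condMarginal hT hd o hβ hx.le hxg s r)⟩
  obtain ⟨μ, hμ, h1⟩ := hex 1
  obtain ⟨ν, hν, h2⟩ := hex (-1)
  obtain rfl := hu.unique hμ hν
  have := hμ.isProbability
  have hm : MeasurableSet {σ : V → ℤˣ | σ o = -1} :=
    (measurable_pi_apply o) (measurableSet_singleton (-1))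
  have h3 := measureReal_union (μ := μ) (s₁ := {σ : V → ℤˣ | σ o = 1})
    (s₂ := {σ : V → ℤˣ | σ o = -1}) (Set.disjoint_left.2 fun σ (h : σ o = 1) (h' : σ o = -1) => by
      rw [h] at h'
      exact absurd h' (by decide)) hm
  have h4 := measureReal_le_one (μ := μ)
    (s := {σ : V → ℤˣ | σ o = 1} ∪ {σ : V → ℤˣ | σ o = -1})
  -- A single Gibbs state would give each of two disjoint events probability above 1/2.
  have h5 : (2 : ℝ)⁻¹ < (1 + Real.exp (-(2 * x)))⁻¹ := by
    have : Real.exp (-(2 * x)) < 1 := Real.exp_lt_one_iff.2 (by linarith)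
    gcongr
    linarith
  linarith

theorem isTranslationInvariant_isingInteraction {Γ : Type*} [Group Γ] [MulAction Γ V]
    (hΓ : ∀ (g : Γ) (u v : V), T.Adj u v → T.Adj (g • u) (g • v)) (β : ℝ) :
    (isingInteraction T β).IsTranslationInvariant Γ := by
  classical
  intro g F σ
  simp only [isingInteraction]
  have hiff : (∃ u v, T.Adj u v ∧ F.map (MulAction.toPerm g).toEmbedding = {u, v}) ↔
      ∃ u v, T.Adj u v ∧ F = {u, v} := by
    constructor
    · rintro ⟨u, v, h, hF⟩
      refine ⟨g⁻¹ • u, g⁻¹ • v, hΓ _ _ _ h, ?_⟩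
      apply Finset.map_injective (MulAction.toPerm g).toEmbedding
      rw [hF]
      simp
    · rintro ⟨u, v, h, rfl⟩
      exact ⟨g • u, g • v, hΓ _ _ _ h, by simp⟩
  refine if_congr hiff ?_ rfl
  congr 2
  refine (Finset.prod_coe_sort (F.map (MulAction.toPerm g).toEmbedding) (spin σ)).trans ?_
  rw [Finset.prod_map]
  exact (Finset.prod_coe_sort F fun v => spin σ (g • v)).symm

theorem mixing_isingInteraction (hT : T.IsTree) {d : ℕ} (hd : T.IsRegularOfDegree d) (o : V)
    {β : ℝ} (hβ : 0 ≤ β) (hle : ((d - 1 : ℕ) : ℝ) * Real.tanh β ≤ 1) (a : ℤˣ) {ε : ℝ}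
    (hε : 0 < ε) : ∃ R : ℕ, ∀ r : ℕ, R ≤ r → ∀ (Ψ : V → ℤˣ → ℝ) (η τ : V → ℤˣ),
      |((isingInteraction T β).addField Ψ).condMarginal (graphBall T o r) η o a -
        ((isingInteraction T β).addField Ψ).condMarginal (graphBall T o r) τ o a| < ε := by
  -- Flipping all of the at most d boundary spins next to a vertex changes its field by at most 2dβ
  -- = 2x.
  set x : ℝ := d * β with hxdef
  have hx : 0 ≤ x := by positivity
  have hlim := tendsto_iterate_edgeMessage hβ hle hx
  -- The 4 is the constant 2 of `abs_inv_one_add_exp_sub_le` times the 2 in `abs_rootField_sub_le`.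
  have hlim2 := ((((continuous_edgeMessage β).tendsto 0).comp hlim).const_mul
    (d : ℝ)).const_mul (4 : ℝ)
  rw [edgeMessage_zero, mul_zero, mul_zero] at hlim2
  obtain ⟨N, hN⟩ := eventually_atTop.1 (hlim2.eventually (gt_mem_nhds hε))
  refine ⟨N + 1, fun r hr Ψ η τ => ?_⟩
  obtain ⟨r, rfl⟩ := Nat.exists_eq_add_of_le' (le_trans (Nat.le_add_left 1 N) hr)
  rw [condMarginal_graphBall hT, condMarginal_graphBall hT]
  refine (abs_inv_one_add_exp_sub_le _ _).trans_lt ?_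
  have ha : |((a : ℤ) : ℝ)| = 1 := abs_spin (fun _ : V => a) o
  rw [← mul_sub, abs_mul, ha, one_mul]
  refine lt_of_le_of_lt ?_ (hN r (by omega))
  have := abs_rootField_sub_le hT hd o hβ r (boundaryField T o β Ψ η (r + 1))
    (boundaryField T o β Ψ τ (r + 1)) x hx
    (fun v hv => by simp [boundaryField, hv.ne]) (fun v hv => by
      simp only [boundaryField, if_pos hv, add_sub_add_left_eq_sub]
      rw [← Finset.sum_sub_distrib]
      refine (Finset.abs_sum_le_sum_abs _ _).trans ?_
      refine (Finset.sum_le_card_nsmul _ _ (2 * β) fun c _ => ?_).trans ?_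
      · rw [← mul_sub, abs_mul, abs_of_nonneg hβ]
        have := abs_sub (spin η c) (spin τ c)
        rw [abs_spin, abs_spin] at this
        nlinarith
      · rw [nsmul_eq_mul, hxdef]
        have : ((T.children o v).card : ℝ) ≤ d := Nat.cast_le.2 (card_children_le hd o v)
        nlinarith)
  simp only [Function.comp_apply]
  linarith

end Ising

end Mixing

theorem mainTheorem3 {V Γ : Type*} [Group Γ] [MulAction Γ V] (d : ℕ)
    (T : SimpleGraph V) [T.LocallyFinite] (hT : T.IsTree) (hd : T.IsRegularOfDegree d)
    (hΓ : ∀ (g : Γ) (u v : V), T.Adj u v → T.Adj (g • u) (g • v))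
    (o : V) (β : ℝ) (hβ : 0 ≤ β)
    (huniq : (isingInteraction T β).HasUniqueGibbsState ∨
      (β : EReal) < isingUniquenessThreshold T) :
    StrongSpatialMixing Γ T o (isingInteraction T β) := by
  have hle : ((d - 1 : ℕ) : ℝ) * Real.tanh β ≤ 1 := by
    rcases huniq with h | h
    · exact mul_tanh_le_one_of_hasUniqueGibbsState hT hd hβ h
    -- Uniqueness at some β' > β suffices: the bound on tanh passes down to β, and uniqueness at β
    -- itself is not needed.
    · obtain ⟨_, ⟨β', ⟨hβ', hu⟩, rfl⟩, hlt⟩ := lt_sSup_iff.1 h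
      have h1 := mul_tanh_le_one_of_hasUniqueGibbsState hT hd hβ' hu
      have h2 : Real.tanh β ≤ Real.tanh β' :=
        tanh_le_tanh_of_le (EReal.coe_lt_coe_iff.1 hlt).le
      exact (mul_le_mul_of_nonneg_left h2 (Nat.cast_nonneg _)).trans h1
  refine ⟨isTranslationInvariant_isingInteraction hΓ β, fun a ε hε => ?_⟩
  obtain ⟨R, hR⟩ := mixing_isingInteraction hT hd o hβ hle a hε
  exact ⟨R, fun r hr Ψ η _ τ _ => hR r hr Ψ η τ⟩
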